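/- Let $\mathcal{A}_0$ be a unital complex $*$-algebra. A state is a linear functional $\omega:\mathcal{A}_0\to\mathbb{C}$ with $\omega(a^*a)\ge 0$ for all $a$ and $\omega(1)=1$. Let $\mathcal{H}_\omega$ be its GNS Hilbert space, i.e. the completion of the space of vectors $|a\omega\rangle$, $a\in\mathcal{A}_0$, modulo null vectors, for $\langle a\omega|b\omega\rangle=\omega(a^*b)$, and write $|\omega\rangle=|1\omega\rangle$. Each $a\in\mathcal{A}_0$ is represented on $\mathcal{H}_\omega$ by the closure of the operator $|b\omega\rangle\mapsto|(ab)\omega\rangle$, with polar decomposition $a=u_a|a|$. Let $\mathcal{A}_\omega$ be the smallest von Neumann algebra on $\mathcal{H}_\omega$ to which all these closed operators are affiliated. The state $\omega$ is called factorial if $\mathcal{A}_\omega$ is a factor. Given two states $\omega_1,\omega_2$ on $\mathcal{A}_0$, write $\omega_2\prec\omega_1$ if there is a density matrix $\rho$ (a positive trace-class operator of trace one) on $\mathcal{H}_{\omega_1}$ such that, for every finite product $w$ of symbols $u_a$, $u_a^\dagger$ and $f(|a|)$, with $a\in\mathcal{A}_0$ and $f$ a bounded Borel function, $$\operatorname{tr}_{\mathcal{H}_{\omega_1}}\big(\rho\,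 w^{(1)}\big)=\langle\omega_2|\,w^{(2)}\,|\omega_2\rangle ,$$ where $w^{(j)}$ denotes the operator on $\mathcal{H}_{\omega_j}$ obtained from $w$ by using the polar decompositions of the elements $a$ as they act on $\mathcal{H}_{\omega_j}$. If $\omega_1$ is factorial and $\omega_2\prec\omega_1$, then $\omega_1\prec\omega_2$. -/

import Mathlib

open scoped InnerProductSpace

set_option linter.unusedSectionVars false

section Polar

variable {H : Type*} [NormedAddCommGroup H] [InnerProductSpace ℂ H] [CompleteSpace H]

/-- `T = u S` is the polar decomposition of the densely defined closed operator `T`: the operator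
`S = |T|` is positive and self-adjoint, `T = u ∘ S` as partially defined operators (with equality
of domains), and `u` is a partial isometry with initial space the closure of the range of `S`. -/
structure IsPolarDecomposition (T : H →ₗ.[ℂ] H) (u : H →L[ℂ] H) (S : H →ₗ.[ℂ] H) : Prop where
  selfAdjoint : IsSelfAdjoint S
  nonneg : ∀ x : S.domain, 0 ≤ (⟪(x : H), S x⟫_ℂ).re
  graph_iff : ∀ x y : H, (x, y) ∈ T.graph ↔ ∃ w : H, (x, w) ∈ S.graph ∧ y = u w
  isometry : ∀ x : S.domain, ‖u (S x)‖ = ‖S x‖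
  apply_eq_zero : ∀ v : H, (∀ x : S.domain, ⟪S x, v⟫_ℂ = 0) → u v = 0

/-- The closure of the graph of `T`, in the Hilbert space `H ⊕ H`. -/
noncomputable def hilbertGraph (T : H →ₗ.[ℂ] H) : Submodule ℂ (WithLp 2 (H × H)) :=
  (T.graph.map (WithLp.linearEquiv 2 ℂ (H × H)).symm.toLinearMap).topologicalClosure

instance (T : H →ₗ.[ℂ] H) : CompleteSpace (hilbertGraph T) :=
  (Submodule.isClosed_topologicalClosure _).completeSpace_coe

/-- The bounded map `z ↦ P (z, 0)`, with `P` the projection of `H ⊕ H` onto the graph of `T`. -/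
noncomputable def graphProj (T : H →ₗ.[ℂ] H) : H →L[ℂ] WithLp 2 (H × H) :=
  (hilbertGraph T).starProjection ∘L
    (WithLp.prodContinuousLinearEquiv 2 ℂ H H).symm.toContinuousLinearMap ∘L
    ContinuousLinearMap.inl ℂ H H

/-- The bounded operator `(1 + T†T)⁻¹` of a closed densely defined operator `T`: the vector
`R z` is the first component of the projection of `(z, 0)` onto the graph of `T`. -/
noncomputable def resolventSq (T : H →ₗ.[ℂ] H) : H →L[ℂ] H :=
  WithLp.fstL 2 ℂ H H ∘L graphProj T

/-- The bounded operator `T (1 + T†T)⁻¹`. -/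
noncomputable def opResolventSq (T : H →ₗ.[ℂ] H) : H →L[ℂ] H :=
  WithLp.sndL 2 ℂ H H ∘L graphProj T

theorem mem_hilbertGraph {T : H →ₗ.[ℂ] H} (hT : T.IsClosed) (p : WithLp 2 (H × H)) :
    p ∈ hilbertGraph T ↔ (p.fst, p.snd) ∈ T.graph := by
  have hcl : IsClosed ((T.graph.map (WithLp.linearEquiv 2 ℂ (H × H)).symm.toLinearMap :
      Submodule ℂ (WithLp 2 (H × H))) : Set (WithLp 2 (H × H))) := by
    have : ((T.graph.map (WithLp.linearEquiv 2 ℂ (H × H)).symm.toLinearMap :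
      Submodule ℂ (WithLp 2 (H × H))) : Set (WithLp 2 (H × H)))
        = (WithLp.prodContinuousLinearEquiv 2 ℂ H H) ⁻¹' (T.graph : Set (H × H)) := by
      ext q
      simp only [Submodule.map_coe, Set.mem_image, Set.mem_preimage]
      constructor
      · rintro ⟨r, hr, rfl⟩
        exact hr
      · intro h
        exact ⟨_, h, rfl⟩
    rw [this]
    exact hT.preimage (WithLp.prodContinuousLinearEquiv 2 ℂ H H).continuous
  rw [hilbertGraph, hcl.submodule_topologicalClosure_eq]
  constructor
  · rintro ⟨r, hr, rfl⟩
    exact hr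
  · intro h
    exact ⟨_, h, rfl⟩

theorem graphProj_mem {T : H →ₗ.[ℂ] H} (hT : T.IsClosed) (z : H) :
    (resolventSq T z, opResolventSq T z) ∈ T.graph :=
  (mem_hilbertGraph hT _).1 (Submodule.starProjection_apply_mem _ _)

theorem inner_graphProj {T : H →ₗ.[ℂ] H} (hT : T.IsClosed) (z : H) {g h : H}
    (hgh : (g, h) ∈ T.graph) :
    ⟪g, z⟫_ℂ = ⟪g, resolventSq T z⟫_ℂ + ⟪h, opResolventSq T z⟫_ℂ := by
  have h1 : (WithLp.toLp 2 (g, h) : WithLp 2 (H × H)) ∈ hilbertGraph T :=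
    (mem_hilbertGraph hT _).2 hgh
  have h2 := (hilbertGraph T).starProjection_inner_eq_zero (WithLp.toLp 2 (z, (0 : H))) _ h1
  have h3 := congrArg (starRingEnd ℂ) h2
  rw [inner_conj_symm, WithLp.prod_inner_apply] at h3
  simp only [map_zero] at h3
  change ⟪g, z - resolventSq T z⟫_ℂ + ⟪h, 0 - opResolventSq T z⟫_ℂ = 0 at h3
  rw [inner_sub_right, inner_sub_right, inner_zero_right] at h3
  linear_combination h3

theorem inner_resolventSq {T : H →ₗ.[ℂ] H} (hT : T.IsClosed) (z w : H) :
    ⟪resolventSq T z, w⟫_ℂ =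
      ⟪resolventSq T z, resolventSq T w⟫_ℂ + ⟪opResolventSq T z, opResolventSq T w⟫_ℂ :=
  inner_graphProj hT w (graphProj_mem hT z)

theorem resolventSq_nonneg {T : H →ₗ.[ℂ] H} (hT : T.IsClosed) : 0 ≤ resolventSq T := by
  rw [ContinuousLinearMap.nonneg_iff_isPositive, ContinuousLinearMap.isPositive_iff_complex]
  intro x
  rw [inner_resolventSq hT, inner_self_eq_norm_sq_to_K, inner_self_eq_norm_sq_to_K]
  norm_cast
  exact ⟨by simp, by positivity⟩

theorem resolventSq_le_one {T : H →ₗ.[ℂ] H} (hT : T.IsClosed) : resolventSq T ≤ 1 := by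
  have hn := fun x => (inner_resolventSq hT x x)
  rw [ContinuousLinearMap.le_def, ContinuousLinearMap.isPositive_iff_complex]
  intro x
  have h1 : ⟪(1 - resolventSq T) x, x⟫_ℂ
      = ((‖x‖ ^ 2 - (‖resolventSq T x‖ ^ 2 + ‖opResolventSq T x‖ ^ 2) : ℝ) : ℂ) := by
    simp only [sub_apply, one_apply_eq_self, inner_sub_left]
    rw [hn x, inner_self_eq_norm_sq_to_K, inner_self_eq_norm_sq_to_K, inner_self_eq_norm_sq_to_K]
    push_cast
    rfl
  have h2 : ‖resolventSq T x‖ ^ 2 + ‖opResolventSq T x‖ ^ 2 ≤ ‖x‖ ^ 2 := by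
    have h3 := (hilbertGraph T).norm_starProjection_apply_le (WithLp.toLp 2 (x, (0 : H)))
    have h4 : ‖(WithLp.toLp 2 (x, (0 : H)) : WithLp 2 (H × H))‖ ^ 2 = ‖x‖ ^ 2 := by
      rw [WithLp.prod_norm_sq_eq_of_L2]; simp
    have h5 := pow_le_pow_left₀ (norm_nonneg _) h3 2
    rw [h4, WithLp.prod_norm_sq_eq_of_L2] at h5
    exact h5
  rw [h1]
  exact ⟨rfl, sub_nonneg.2 h2⟩

theorem resolventSq_injective {T : H →ₗ.[ℂ] H} (hT : T.IsClosed)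
    (hd : Dense (T.domain : Set H)) {z : H} (hz : resolventSq T z = 0) : z = 0 := by
  have h1 := graphProj_mem hT z
  rw [hz] at h1
  have h2 : opResolventSq T z = 0 := T.graph_fst_eq_zero_snd h1 rfl
  refine hd.eq_zero_of_inner_right ℂ fun v hv => ?_
  have := inner_graphProj hT z (T.mem_graph ⟨v, hv⟩)
  simpa [hz, h2] using this

/-- A bounded operator of the same norm on every vector factors through a partial isometry. -/
theorem exists_partialIsometry (N B : H →L[ℂ] H) (h : ∀ z, ‖B z‖ = ‖N z‖) :
    ∃ u : H →L[ℂ] H, (∀ z, u (N z) = B z) ∧ ∀ v, (∀ z, ⟪N z, v⟫_ℂ = 0) → u v = 0 := by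
  let K := (LinearMap.range N.toLinearMap).topologicalClosure
  have : CompleteSpace K := (Submodule.isClosed_topologicalClosure _).completeSpace_coe
  have hmem : ∀ z, N z ∈ K := fun z => Submodule.le_topologicalClosure _ ⟨z, rfl⟩
  let e : H →ₗ[ℂ] K := N.toLinearMap.codRestrict K hmem
  have hde : DenseRange e := by
    intro y
    have hy : (y : H) ∈ closure (Set.range N) := y.2
    rw [Metric.mem_closure_iff] at hy ⊢
    intro ε hε
    obtain ⟨_, ⟨z, rfl⟩, hz⟩ := hy ε hε
    exact ⟨e z, ⟨z, rfl⟩, hz⟩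
  let u0 : K →L[ℂ] H := B.toLinearMap.extendOfNorm e
  have hu0 : ∀ z, u0 (e z) = B z := fun z =>
    LinearMap.extendOfNorm_eq hde ⟨1, fun x => (one_mul ‖e x‖).symm ▸ (h x).le⟩ z
  refine ⟨u0 ∘L K.orthogonalProjectionOnto, fun z => ?_, fun v hv => ?_⟩
  · have : K.orthogonalProjectionOnto (N z) = e z :=
      Submodule.orthogonalProjectionOnto_mem_subspace_eq_self (e z)
    simp [this, hu0]
  · have : v ∈ Kᗮ := by
      rw [Submodule.orthogonal_closure]
      rintro _ ⟨z, rfl⟩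
      exact hv z
    simp [Submodule.orthogonalProjectionOnto_eq_zero_iff.2 this]

theorem exists_polarDecomposition (T : H →ₗ.[ℂ] H) (hT : T.IsClosed)
    (hd : Dense (T.domain : Set H)) :
    ∃ (u : H →L[ℂ] H) (S : H →ₗ.[ℂ] H), IsPolarDecomposition T u S := by
  set R := resolventSq T with hR
  set B := opResolventSq T with hB
  have hR0 : 0 ≤ R := resolventSq_nonneg hT
  have hR1 : 0 ≤ 1 - R := sub_nonneg.2 (resolventSq_le_one hT)
  have hRsa : IsSelfAdjoint R := .of_nonneg hR0
  have h1R : (1 - R) = cfc (fun r : ℝ => 1 - r) R := by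
    rw [cfc_sub (fun _ => (1 : ℝ)) (fun r => r) R, cfc_const_one ℝ R, cfc_id' ℝ R]
  let C := CFC.sqrt R
  let D := CFC.sqrt (1 - R)
  have hC0 : 0 ≤ C := CFC.sqrt_nonneg _
  have hD0 : 0 ≤ D := CFC.sqrt_nonneg _
  have hCC : C * C = R := CFC.sqrt_mul_sqrt_self R
  have hDD : D * D = 1 - R := CFC.sqrt_mul_sqrt_self (1 - R)
  have hcomm : Commute C D := by
    have e1 : C = cfc Real.sqrt R := (CFC.sqrt_eq_real_sqrt R).trans cfcₙ_eq_cfc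
    have e2 : D = cfc (fun r : ℝ => Real.sqrt (1 - r)) R := by
      change CFC.sqrt (1 - R) = _
      rw [CFC.sqrt_eq_real_sqrt (1 - R), cfcₙ_eq_cfc, h1R, ← cfc_comp' Real.sqrt (fun r : ℝ => 1 - r) R]
    rw [e1, e2]
    exact cfc_commute_cfc _ _ _
  have hCD0 : 0 ≤ C * D := hcomm.mul_nonneg hC0 hD0
  have hCs : ∀ x y, ⟪C x, y⟫_ℂ = ⟪x, C y⟫_ℂ := fun x y =>
    ((ContinuousLinearMap.nonneg_iff_isPositive _).1 hC0).inner_left_eq_inner_right x y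
  have hDs : ∀ x y, ⟪D x, y⟫_ℂ = ⟪x, D y⟫_ℂ := fun x y =>
    ((ContinuousLinearMap.nonneg_iff_isPositive _).1 hD0).inner_left_eq_inner_right x y
  have hCCx : ∀ x, C (C x) = R x := fun x => DFunLike.congr_fun hCC x
  have hDDx : ∀ x, D (D x) = x - R x := fun x => DFunLike.congr_fun hDD x
  have hCDx : ∀ x, C (D x) = D (C x) := fun x => DFunLike.congr_fun hcomm.eq x
  have hsum : ∀ x, C (C x) + D (D x) = x := fun x => by rw [hCCx, hDDx]; abel
  have hCinj : ∀ x, C x = 0 → x = 0 := fun x hx => by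
    apply resolventSq_injective hT hd
    change R x = 0
    rw [← hCCx, hx, map_zero]
  have hCdense : Dense (Set.range C) := by
    have h2 : (LinearMap.range C.toLinearMap)ᗮ = ⊥ := by
      rw [Submodule.eq_bot_iff]
      intro v hv
      apply hCinj
      rw [← inner_self_eq_zero (𝕜 := ℂ), hCs]
      exact (Submodule.mem_orthogonal' _ _).1 hv _ ⟨C v, rfl⟩
    exact Submodule.dense_iff_topologicalClosure_eq_top.2
      (Submodule.topologicalClosure_eq_top_iff.2 h2)
  let G : Submodule ℂ (H × H) := LinearMap.range (C.prod D).toLinearMap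
  let S : H →ₗ.[ℂ] H := G.toLinearPMap
  have hSG : S.graph = G := by
    apply Submodule.toLinearPMap_graph_eq
    rintro _ ⟨y, rfl⟩ hy
    have : y = 0 := hCinj y hy
    simp [this]
  have hS : ∀ x w, (x, w) ∈ S.graph ↔ ∃ y, C y = x ∧ D y = w := by
    intro x w
    rw [hSG]
    constructor
    · rintro ⟨y, hy⟩
      exact ⟨y, congrArg Prod.fst hy, congrArg Prod.snd hy⟩
    · rintro ⟨y, rfl, rfl⟩
      exact ⟨y, rfl⟩
  have hSval : ∀ x : S.domain, ∃ y, C y = (x : H) ∧ D y = S x := fun x =>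
    (hS _ _).1 (S.mem_graph x)
  have hSval' : ∀ y, ∃ x : S.domain, (x : H) = C y ∧ S x = D y := fun y => by
    obtain ⟨x, hx⟩ := (S.mem_graph_iff).1 ((hS (C y) (D y)).2 ⟨y, rfl, rfl⟩)
    exact ⟨x, hx⟩
  have hSd : Dense (S.domain : Set H) := by
    refine hCdense.mono ?_
    rintro _ ⟨y, rfl⟩
    obtain ⟨x, hx, -⟩ := hSval' y
    exact hx ▸ x.2
  have hSsa : IsSelfAdjoint S := by
    rw [LinearPMap.isSelfAdjoint_def]
    apply LinearPMap.eq_of_eq_graph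
    rw [LinearPMap.adjoint_graph_eq_graph_adjoint hSd]
    ext ⟨v, w⟩
    rw [Submodule.mem_adjoint_iff, hS]
    constructor
    · intro h
      have h1 : ∀ y, ⟪y, D v⟫_ℂ - ⟪y, C w⟫_ℂ = 0 := fun y => by
        rw [← hDs, ← hCs]
        exact h _ _ ((hS _ _).2 ⟨y, rfl, rfl⟩)
      have h2 : D v = C w := by
        refine ext_inner_left ℂ fun y => ?_
        exact sub_eq_zero.1 (h1 y)
      refine ⟨C v + D w, ?_, ?_⟩
      · rw [map_add, hCDx, ← h2, hsum]
      · rw [map_add, ← hCDx, h2, hsum]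
    · rintro ⟨y, rfl, rfl⟩ a b hab
      obtain ⟨z, rfl, rfl⟩ := (hS _ _).1 hab
      change ⟪D z, C y⟫_ℂ - ⟪C z, D y⟫_ℂ = 0
      rw [hDs, hCs, hCDx, sub_self]
  have hBn : ∀ z, ‖B z‖ = ‖(C * D) z‖ := fun z => by
    have h1 : ((‖B z‖ ^ 2 : ℝ) : ℂ) = ((‖(C * D) z‖ ^ 2 : ℝ) : ℂ) := by
      have h2 := inner_resolventSq hT z z
      change ⟪R z, z⟫_ℂ = ⟪R z, R z⟫_ℂ + ⟪B z, B z⟫_ℂ at h2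
      have h3 : ⟪(C * D) z, (C * D) z⟫_ℂ = ⟪R z, z⟫_ℂ - ⟪R z, R z⟫_ℂ := by
        change ⟪C (D z), C (D z)⟫_ℂ = _
        rw [hCDx, hDs, hDDx, inner_sub_right, hCs z, hCs z, ← hCCx (C z), hCCx z]
        have e1 : ⟪z, R z⟫_ℂ = ⟪R z, z⟫_ℂ := by rw [← hCCx, ← hCs, ← hCs]
        have e2 : C (C (C (C z))) = R (R z) := by rw [hCCx, hCCx]
        have e3 : ⟪z, R (R z)⟫_ℂ = ⟪R z, R z⟫_ℂ := by
          rw [← e2, ← hCs, ← hCs, hCCx]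
        rw [e1, hCCx (R z), e3]
      have h4 : ⟪B z, B z⟫_ℂ = ⟪(C * D) z, (C * D) z⟫_ℂ := by
        rw [h3]; linear_combination -h2
      rw [inner_self_eq_norm_sq_to_K, inner_self_eq_norm_sq_to_K] at h4
      push_cast
      exact h4
    have h5 : ‖B z‖ ^ 2 = ‖(C * D) z‖ ^ 2 := by exact_mod_cast h1
    exact (pow_left_inj₀ (norm_nonneg _) (norm_nonneg _) two_ne_zero).1 h5
  obtain ⟨u, huN, hu0⟩ := exists_partialIsometry (C * D) B hBn
  have huiso : ∀ y, ‖u (D y)‖ = ‖D y‖ := by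
    intro y
    have hcl : IsClosed {y | ‖u (D y)‖ = ‖D y‖} :=
      isClosed_eq (by fun_prop) (by fun_prop)
    refine hCdense.induction (P := fun y => ‖u (D y)‖ = ‖D y‖) ?_ hcl y
    rintro _ ⟨z, rfl⟩
    rw [← hCDx]
    exact (congrArg norm (huN z)).trans (hBn z)
  have hTS : ∀ y, (C y, u (D y)) ∈ T.graph := by
    intro y
    have hcl : IsClosed {y | (C y, u (D y)) ∈ T.graph} :=
      hT.preimage (f := fun y => (C y, u (D y))) (by fun_prop)
    refine hCdense.induction (P := fun y => (C y, u (D y)) ∈ T.graph) ?_ hcl y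
    rintro _ ⟨z, rfl⟩
    rw [hCCx, ← hCDx]
    have := graphProj_mem hT z
    rwa [← hB, ← hR, ← huN z] at this
  have huD : ∀ a, D (u.adjoint (u (D a))) = D (D a) := by
    have h1 : D ∘L u.adjoint ∘L u ∘L D = D ∘L D := by
      apply ContinuousLinearMap.coe_inj.1
      refine (ext_inner_map _ _).1 fun x => ?_
      change ⟪D (u.adjoint (u (D x))), x⟫_ℂ = ⟪D (D x), x⟫_ℂ
      rw [hDs, hDs, ContinuousLinearMap.adjoint_inner_left, inner_self_eq_norm_sq_to_K,
        inner_self_eq_norm_sq_to_K, huiso]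
    exact fun a => DFunLike.congr_fun h1 a
  have hST : ∀ x y, (x, y) ∈ T.graph → ∃ a, C a = x ∧ u (D a) = y := by
    intro x y hxy
    let a := C x + D (u.adjoint y)
    have hsub : (x - C a, y - u (D a)) ∈ T.graph := T.graph.sub_mem hxy (hTS a)
    have h0 : C (x - C a) + D (u.adjoint (y - u (D a))) = 0 := by
      rw [map_sub, map_sub, map_sub, huD]
      have h1 := hsum a
      calc C x - C (C a) + (D (u.adjoint y) - D (D a)) = a - (C (C a) + D (D a)) := by
            change _ = C x + D (u.adjoint y) - _
            abel
        _ = 0 := by rw [h1, sub_self]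
    have hx : x - C a = 0 := by
      refine ext_inner_right ℂ fun z => ?_
      have h1 := inner_graphProj hT z hsub
      have h2 : ⟪y - u (D a), B z⟫_ℂ = ⟪D (u.adjoint (y - u (D a))), C z⟫_ℂ := by
        rw [← huN z, hDs, ContinuousLinearMap.adjoint_inner_left]
        change _ = ⟪_, u (D (C z))⟫_ℂ
        rw [← hCDx]
        rfl
      have h3 : ⟪x - C a, R z⟫_ℂ = ⟪C (x - C a), C z⟫_ℂ := by rw [← hCCx, hCs]
      change _ = ⟪x - C a, R z⟫_ℂ + ⟪y - u (D a), B z⟫_ℂ at h1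
      rw [h1, h2, h3, ← inner_add_left, h0, inner_zero_left, inner_zero_left]
    rw [hx] at hsub
    have hy : y - u (D a) = 0 := T.graph_fst_eq_zero_snd hsub rfl
    exact ⟨a, (sub_eq_zero.1 hx).symm, (sub_eq_zero.1 hy).symm⟩
  refine ⟨u, S, hSsa, ?_, ?_, ?_, ?_⟩
  · intro x
    obtain ⟨y, hy1, hy2⟩ := hSval x
    rw [← hy1, ← hy2, hCs]
    exact ((ContinuousLinearMap.nonneg_iff_isPositive _).1 hCD0).re_inner_nonneg_right y
  · intro x y
    constructor
    · intro h
      obtain ⟨a, ha, ha'⟩ := hST x y h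
      exact ⟨D a, (hS _ _).2 ⟨a, ha, rfl⟩, ha'.symm⟩
    · rintro ⟨w, hw, rfl⟩
      obtain ⟨a, rfl, rfl⟩ := (hS _ _).1 hw
      exact hTS a
  · intro x
    obtain ⟨y, -, hy2⟩ := hSval x
    rw [← hy2]
    exact huiso y
  · intro v hv
    refine hu0 v fun z => ?_
    obtain ⟨x, -, hx⟩ := hSval' (C z)
    have := hv x
    rw [hx, ← hCDx] at this
    exact this

end Polar
section BorelCalculus

open MeasureTheory Filter Topology
open scoped CompactlySupported

variable {H : Type*} [NormedAddCommGroup H] [InnerProductSpace ℂ H] [CompleteSpace H]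

/-- The positive functional `φ ↦ ⟨x, φ(R) x⟩` on `C_c(ℝ)`. -/
noncomputable def vectorFunctional (R : H →L[ℂ] H) (x : H) : C_c(ℝ, ℝ) →ₚ[ℝ] ℝ :=
  PositiveLinearMap.mk₀
    { toFun := fun φ => (⟪x, cfc (φ : ℝ → ℝ) R x⟫_ℂ).re
      map_add' := fun φ ψ => by
        have : cfc ((φ + ψ : C_c(ℝ, ℝ)) : ℝ → ℝ) R = cfc (φ : ℝ → ℝ) R + cfc (ψ : ℝ → ℝ) R :=
          cfc_add (a := R) φ ψ φ.continuous.continuousOn ψ.continuous.continuousOn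
        rw [this, add_apply, inner_add_right, Complex.add_re]
      map_smul' := fun c φ => by
        have : cfc ((c • φ : C_c(ℝ, ℝ)) : ℝ → ℝ) R = c • cfc (φ : ℝ → ℝ) R :=
          cfc_smul (a := R) c φ φ.continuous.continuousOn
        rw [this, smul_apply, RCLike.real_smul_eq_coe_smul (K := ℂ), inner_smul_right]
        simp }
    (fun φ hφ => by
      have h0 : 0 ≤ cfc (φ : ℝ → ℝ) R := cfc_nonneg fun r _ => hφ r
      exact ((ContinuousLinearMap.nonneg_iff_isPositive _).1 h0).re_inner_nonneg_right x)

/-- The spectral measure of the bounded self-adjoint operator `R` at the vector `x`: the measure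
`μ` on `ℝ` with `∫ φ dμ = ⟨x, φ(R) x⟩` for every continuous `φ` of compact support. -/
noncomputable def vectorMeasure (R : H →L[ℂ] H) (x : H) : Measure ℝ :=
  RealRMK.rieszMeasure (vectorFunctional R x)

theorem integral_vectorMeasure {R : H →L[ℂ] H} (x : H) (φ : C_c(ℝ, ℝ)) :
    ((∫ r, φ r ∂(vectorMeasure R x) : ℝ) : ℂ) = ⟪x, cfc (φ : ℝ → ℝ) R x⟫_ℂ := by
  rw [vectorMeasure, RealRMK.integral_rieszMeasure]
  have h : IsSelfAdjoint (cfc (φ : ℝ → ℝ) R) := cfc_predicate _ _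
  change (((⟪x, cfc (φ : ℝ → ℝ) R x⟫_ℂ).re : ℝ) : ℂ) = _
  rw [← Complex.conj_eq_iff_re, inner_conj_symm]
  exact h.isSymmetric x x

/-- A compactly supported function equal to one on `[-n, n]`. -/
theorem exists_cutoff (n : ℕ) : ∃ φ : C_c(ℝ, ℝ), (∀ r : ℝ, |r| ≤ n → φ r = 1) ∧
    ∀ r, 0 ≤ φ r ∧ φ r ≤ 1 := by
  refine ⟨⟨⟨fun r => max 0 (min 1 (n + 1 - |r|)), by fun_prop⟩, ?_⟩, ?_, ?_⟩
  · refine HasCompactSupport.of_support_subset_isCompact (K := Set.Icc (-(n + 1) : ℝ) (n + 1))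
      isCompact_Icc ?_
    intro r hr
    rw [Set.mem_Icc, ← abs_le]
    by_contra h
    apply hr
    change max 0 (min 1 ((n : ℝ) + 1 - |r|)) = 0
    apply max_eq_left
    exact (min_le_right _ _).trans (by linarith [not_le.1 h])
  · intro r hr
    change max 0 (min 1 ((n : ℝ) + 1 - |r|)) = 1
    rw [min_eq_left (by linarith), max_eq_right zero_le_one]
  · intro r
    exact ⟨le_max_left _ _, max_le zero_le_one (min_le_left _ _)⟩

theorem vectorMeasure_univ_le (R : H →L[ℂ] H) (x : H) :
    vectorMeasure R x Set.univ ≤ ENNReal.ofReal (‖x‖ ^ 2) := by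
  have hU : (Set.univ : Set ℝ) = ⋃ n : ℕ, Set.Icc (-(n : ℝ)) n := by
    ext r
    simp only [Set.mem_univ, Set.mem_iUnion, Set.mem_Icc, true_iff, ← abs_le]
    exact exists_nat_ge |r|
  rw [hU, Monotone.measure_iUnion]
  · refine iSup_le fun n => ?_
    obtain ⟨φ, h1, h2⟩ := exists_cutoff n
    refine (RealRMK.rieszMeasure_le_of_eq_one _ (fun r => (h2 r).1) isCompact_Icc
      (fun r hr => h1 r (abs_le.2 hr))).trans ?_
    apply ENNReal.ofReal_le_ofReal
    have h0 : ‖cfc (φ : ℝ → ℝ) R‖ ≤ 1 := norm_cfc_le zero_le_one fun r _ => by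
      rw [Real.norm_eq_abs, abs_of_nonneg (h2 r).1]; exact (h2 r).2
    calc (⟪x, cfc (φ : ℝ → ℝ) R x⟫_ℂ).re ≤ ‖⟪x, cfc (φ : ℝ → ℝ) R x⟫_ℂ‖ := Complex.re_le_norm _
      _ ≤ ‖x‖ * ‖cfc (φ : ℝ → ℝ) R x‖ := norm_inner_le_norm _ _
      _ ≤ ‖x‖ * (1 * ‖x‖) := by
        gcongr
        exact ContinuousLinearMap.le_of_opNorm_le _ h0 x
      _ = ‖x‖ ^ 2 := by ring
  · intro m n hmn
    exact Set.Icc_subset_Icc (by simpa using hmn) (by simpa using hmn)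

instance (R : H →L[ℂ] H) (x : H) : IsFiniteMeasure (vectorMeasure R x) :=
  ⟨(vectorMeasure_univ_le R x).trans_lt ENNReal.ofReal_lt_top⟩

theorem norm_le_of_quadratic_le (T : H →L[ℂ] H) {K : ℝ}
    (hb : ∀ x, ‖⟪T x, x⟫_ℂ‖ ≤ K * ‖x‖ ^ 2) (y : H) : ‖T y‖ ≤ 4 * K * ‖y‖ := by
  by_cases hy : y = 0
  · simp [hy]
  have hy0 : 0 < ‖y‖ := norm_pos_iff.2 hy
  have hK : 0 ≤ K := by
    by_contra h
    have h1 := (norm_nonneg _).trans (hb y)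
    nlinarith [pow_pos hy0 2, not_le.1 h]
  by_cases hT : T y = 0
  · rw [hT, norm_zero]; positivity
  have hT0 : 0 < ‖T y‖ := norm_pos_iff.2 hT
  have key : ∀ x : H, ‖x‖ = ‖y‖ → ‖⟪T y, x⟫_ℂ‖ ≤ 4 * K * ‖y‖ ^ 2 := by
    intro x hx
    have hq : ∀ z : H, ‖z‖ ≤ ‖y‖ + ‖y‖ → ‖⟪T z, z⟫_ℂ‖ ≤ 4 * K * ‖y‖ ^ 2 := fun z hz =>
      (hb z).trans ((mul_le_mul_of_nonneg_left
        (pow_le_pow_left₀ (norm_nonneg z) hz 2) hK).trans (le_of_eq (by ring)))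
    have hI : ‖Complex.I • y‖ = ‖y‖ := by rw [norm_smul, Complex.norm_I, one_mul]
    have h1 := hq (x + y) ((norm_add_le _ _).trans (by rw [hx]))
    have h2 := hq (x - y) ((norm_sub_le _ _).trans (by rw [hx]))
    have h3 := hq (x + Complex.I • y) ((norm_add_le _ _).trans (by rw [hx, hI]))
    have h4 := hq (x - Complex.I • y) ((norm_sub_le _ _).trans (by rw [hx, hI]))
    have hp := inner_map_polarization (T : H →ₗ[ℂ] H) x y
    change ⟪T y, x⟫_ℂ = (⟪T (x + y), x + y⟫_ℂ - ⟪T (x - y), x - y⟫_ℂ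
      + Complex.I * ⟪T (x + Complex.I • y), x + Complex.I • y⟫_ℂ
      - Complex.I * ⟪T (x - Complex.I • y), x - Complex.I • y⟫_ℂ) / 4 at hp
    rw [hp, norm_div]
    have h5 : ‖(4 : ℂ)‖ = 4 := by norm_num
    rw [h5, div_le_iff₀ (by norm_num)]
    refine (norm_sub_le _ _).trans ?_
    refine (add_le_add_left ((norm_add_le _ _).trans
      (add_le_add_left (norm_sub_le _ _) _)) _).trans ?_
    rw [norm_mul, norm_mul, Complex.norm_I, one_mul, one_mul]
    linarith
  have h1 := key (((‖y‖ / ‖T y‖ : ℝ) : ℂ) • T y) (by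
    rw [norm_smul, Complex.norm_real, Real.norm_of_nonneg (by positivity)]
    field_simp)
  rw [inner_smul_right, inner_self_eq_norm_sq_to_K, norm_mul, Complex.norm_real,
    Real.norm_of_nonneg (by positivity)] at h1
  have h2 : ‖((‖T y‖ : ℂ) ^ 2)‖ = ‖T y‖ ^ 2 := by simp
  erw [h2] at h1
  have h3 : ‖y‖ / ‖T y‖ * ‖T y‖ ^ 2 = ‖y‖ * ‖T y‖ := by field_simp
  rw [h3] at h1
  nlinarith

/-- A bounded weak limit of bounded operators is a bounded operator. -/
theorem exists_weakLimit (C : ℕ → H →L[ℂ] H) (q : H → ℂ) (K : ℝ)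
    (hb : ∀ n x, ‖⟪C n x, x⟫_ℂ‖ ≤ K * ‖x‖ ^ 2)
    (hq : ∀ x, Tendsto (fun n => ⟪C n x, x⟫_ℂ) atTop (𝓝 (q x))) :
    ∃ D : H →L[ℂ] H, ∀ x, ⟪D x, x⟫_ℂ = q x := by
  have hlim : ∀ y x, ∃ b, Tendsto (fun n => ⟪C n y, x⟫_ℂ) atTop (𝓝 b) := by
    intro y x
    refine ⟨(q (x + y) - q (x - y) + Complex.I * q (x + Complex.I • y)
      - Complex.I * q (x - Complex.I • y)) / 4, ?_⟩
    have h := ((((hq (x + y)).sub (hq (x - y))).add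
      ((hq (x + Complex.I • y)).const_mul Complex.I)).sub
      ((hq (x - Complex.I • y)).const_mul Complex.I)).div_const 4
    refine h.congr fun n => ?_
    exact (inner_map_polarization (C n : H →ₗ[ℂ] H) x y).symm
  choose b hbl using hlim
  have hbound : ∀ y x, ‖b y x‖ ≤ 4 * K * ‖y‖ * ‖x‖ := fun y x =>
    le_of_tendsto (hbl y x).norm (Eventually.of_forall fun n =>
      (norm_inner_le_norm _ _).trans
        (mul_le_mul_of_nonneg_right (norm_le_of_quadratic_le (C n) (hb n) y) (norm_nonneg _)))
  let B0 : H →ₗ⋆[ℂ] H →ₗ[ℂ] ℂ := LinearMap.mk₂'ₛₗ (starRingEnd ℂ) (RingHom.id ℂ) b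
    (fun y z x => tendsto_nhds_unique (hbl (y + z) x)
      (((hbl y x).add (hbl z x)).congr fun n => by rw [map_add, inner_add_left]))
    (fun c y x => tendsto_nhds_unique (hbl (c • y) x)
      (((hbl y x).const_mul _).congr fun n => by rw [map_smul, inner_smul_left]))
    (fun y x z => tendsto_nhds_unique (hbl y (x + z))
      (((hbl y x).add (hbl y z)).congr fun n => by rw [inner_add_right]))
    (fun c y x => tendsto_nhds_unique (hbl y (c • x))
      (((hbl y x).const_mul _).congr fun n => by rw [inner_smul_right]; rfl))
  let B : H →L⋆[ℂ] H →L[ℂ] ℂ := LinearMap.mkContinuous₂ B0 (4 * K) hbound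
  refine ⟨InnerProductSpace.continuousLinearMapOfBilin B, fun x => ?_⟩
  rw [InnerProductSpace.continuousLinearMapOfBilin_apply]
  exact tendsto_nhds_unique (hbl x x) (hq x)

/-- There is a bounded operator `D` with `⟨x, D x⟩ = ∫ f dμ_x`, where `μ_x` is the spectral
measure of `R` at `x`; that is, `D = f(R)`. -/
def HasBorelCalculus (R : H →L[ℂ] H) (f : ℝ → ℂ) : Prop :=
  ∃ D : H →L[ℂ] H, ∀ x, ⟪x, D x⟫_ℂ = ∫ r, f r ∂(vectorMeasure R x)

theorem integrable_of_bounded (R : H →L[ℂ] H) (x : H) {f : ℝ → ℂ} (hf : Measurable f) {K : ℝ}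
    (hb : ∀ t, ‖f t‖ ≤ K) : Integrable f (vectorMeasure R x) :=
  Integrable.of_bound hf.aestronglyMeasurable K (Eventually.of_forall hb)

theorem HasBorelCalculus.limit {R : H →L[ℂ] H} {f : ℕ → ℝ → ℂ} {g : ℝ → ℂ} {K : ℝ} (hK : 0 ≤ K)
    (hf : ∀ n, Measurable (f n)) (hb : ∀ n t, ‖f n t‖ ≤ K)
    (hlim : ∀ t, Tendsto (fun n => f n t) atTop (𝓝 (g t)))
    (hP : ∀ n, HasBorelCalculus R (f n)) : HasBorelCalculus R g := by
  choose D hD using hP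
  have hD' : ∀ n x, ⟪(D n).adjoint x, x⟫_ℂ = ∫ r, f n r ∂(vectorMeasure R x) := fun n x => by
    rw [ContinuousLinearMap.adjoint_inner_left, hD]
  suffices h : ∃ E : H →L[ℂ] H, ∀ x, ⟪E x, x⟫_ℂ = ∫ r, g r ∂(vectorMeasure R x) by
    obtain ⟨E, hE⟩ := h
    exact ⟨E.adjoint, fun x => by rw [ContinuousLinearMap.adjoint_inner_right, hE]⟩
  refine exists_weakLimit (fun n => (D n).adjoint) _ K (fun n x => ?_) (fun x => ?_)
  · rw [hD']
    have h1 : ‖∫ r, f n r ∂(vectorMeasure R x)‖ ≤ K * (vectorMeasure R x).real Set.univ :=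
      norm_integral_le_of_norm_le_const (Eventually.of_forall (hb n))
    refine h1.trans (mul_le_mul_of_nonneg_left ?_ hK)
    exact ENNReal.toReal_le_of_le_ofReal (by positivity) (vectorMeasure_univ_le R x)
  · simp_rw [hD']
    exact tendsto_integral_of_dominated_convergence (fun _ => K)
      (fun n => (hf n).aestronglyMeasurable) (integrable_const K)
      (fun n => Eventually.of_forall (hb n)) (Eventually.of_forall hlim)

theorem HasBorelCalculus.add {R : H →L[ℂ] H} {f g : ℝ → ℂ} {K L : ℝ}
    (hf : Measurable f) (hfb : ∀ t, ‖f t‖ ≤ K) (hg : Measurable g) (hgb : ∀ t, ‖g t‖ ≤ L)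
    (h1 : HasBorelCalculus R f) (h2 : HasBorelCalculus R g) :
    HasBorelCalculus R (fun t => f t + g t) := by
  obtain ⟨D, hD⟩ := h1
  obtain ⟨E, hE⟩ := h2
  refine ⟨D + E, fun x => ?_⟩
  rw [integral_add (integrable_of_bounded R x hf hfb) (integrable_of_bounded R x hg hgb),
    ← hD, ← hE, add_apply, inner_add_right]

theorem HasBorelCalculus.const_mul {R : H →L[ℂ] H} {f : ℝ → ℂ} (c : ℂ)
    (h : HasBorelCalculus R f) : HasBorelCalculus R (fun t => c * f t) := by
  obtain ⟨D, hD⟩ := h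
  refine ⟨c • D, fun x => ?_⟩
  rw [integral_const_mul, ← hD, smul_apply, inner_smul_right]

theorem HasBorelCalculus.compactlySupported (R : H →L[ℂ] H) (φ : C_c(ℝ, ℝ)) :
    HasBorelCalculus R (fun t => (φ t : ℂ)) := by
  refine ⟨cfc (φ : ℝ → ℝ) R, fun x => ?_⟩
  rw [integral_complex_ofReal, integral_vectorMeasure]

theorem HasBorelCalculus.continuous (R : H →L[ℂ] H) {g : ℝ → ℝ} (hg : Continuous g) {K : ℝ}
    (hb : ∀ t, ‖g t‖ ≤ K) : HasBorelCalculus R (fun t => (g t : ℂ)) := by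
  choose φ h1 h2 using exists_cutoff
  have hK : 0 ≤ K := (norm_nonneg _).trans (hb 0)
  let ψ : ℕ → C_c(ℝ, ℝ) := fun n =>
    ⟨⟨fun t => g t * φ n t, hg.mul (φ n).continuous⟩, (φ n).hasCompactSupport.mul_left⟩
  refine HasBorelCalculus.limit (f := fun n t => ((ψ n t : ℝ) : ℂ)) hK
    (fun n => Complex.measurable_ofReal.comp (ψ n).continuous.measurable) (fun n t => ?_)
    (fun t => ?_) (fun n => HasBorelCalculus.compactlySupported R (ψ n))
  · rw [Complex.norm_real]
    change ‖g t * φ n t‖ ≤ K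
    rw [norm_mul, Real.norm_of_nonneg (h2 n t).1]
    exact (mul_le_of_le_one_right (norm_nonneg _) (h2 n t).2).trans (hb t)
  · refine tendsto_const_nhds.congr' ?_
    obtain ⟨N, hN⟩ := exists_nat_ge |t|
    filter_upwards [eventually_ge_atTop N] with n hn
    change (g t : ℂ) = ((g t * φ n t : ℝ) : ℂ)
    rw [h1 n t (hN.trans (by exact_mod_cast hn)), mul_one]

theorem HasBorelCalculus.one (R : H →L[ℂ] H) : HasBorelCalculus R (fun _ => 1) := by
  have := HasBorelCalculus.continuous R (g := fun _ => 1) continuous_const (K := 1) (by simp)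
  simpa using this

theorem measurable_indicator_one {s : Set ℝ} (hs : MeasurableSet s) :
    Measurable (s.indicator fun _ => (1 : ℂ)) := measurable_const.indicator hs

theorem norm_indicator_one_le (s : Set ℝ) (t : ℝ) : ‖s.indicator (fun _ => (1 : ℂ)) t‖ ≤ 1 := by
  by_cases h : t ∈ s <;> simp [h]

theorem HasBorelCalculus.indicator (R : H →L[ℂ] H) {s : Set ℝ} (hs : MeasurableSet s) :
    HasBorelCalculus R (s.indicator fun _ => 1) := by
  induction s, hs using MeasurableSpace.induction_on_inter
    (BorelSpace.measurable_eq.trans (borel_eq_generateFrom_isClosed (α := ℝ)))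
    isPiSystem_isClosed with
  | empty =>
    have := (HasBorelCalculus.one R).const_mul 0
    simpa using this
  | basic s hs =>
    have hs : IsClosed s := hs
    have hpos : ∀ n : ℕ, (0 : ℝ) < 1 / ((n : ℝ) + 1) := fun n => Nat.one_div_pos_of_nat
    have hl := thickenedIndicator_tendsto_indicator_closure hpos
      tendsto_one_div_add_atTop_nhds_zero_nat s
    rw [tendsto_pi_nhds, hs.closure_eq] at hl
    refine HasBorelCalculus.limit (K := 1)
      (f := fun n t => (((thickenedIndicator (hpos n) s t : NNReal) : ℝ) : ℂ)) zero_le_one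
      (fun n => ?_) (fun n t => ?_) (fun t => ?_) (fun n => ?_)
    · exact Complex.measurable_ofReal.comp
        (NNReal.continuous_coe.comp (thickenedIndicator (hpos n) s).continuous).measurable
    · rw [Complex.norm_real, Real.norm_of_nonneg (NNReal.coe_nonneg _)]
      exact_mod_cast thickenedIndicator_le_one (hpos n) s t
    · have h1 := (Complex.continuous_ofReal.comp NNReal.continuous_coe).continuousAt.tendsto.comp
        (hl t)
      refine Eq.subst (motive := fun z => Tendsto _ atTop (𝓝 z)) ?_ h1
      by_cases h : t ∈ s <;> simp [h]
    · refine HasBorelCalculus.continuous R (K := 1)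
        (NNReal.continuous_coe.comp (thickenedIndicator (hpos n) s).continuous) fun t => ?_
      rw [Real.norm_of_nonneg (NNReal.coe_nonneg _)]
      exact_mod_cast thickenedIndicator_le_one (hpos n) s t
  | compl s hs ih =>
    have h1 := (HasBorelCalculus.one R).add (K := 1) (L := 1) measurable_const (by simp)
      ((measurable_indicator_one hs).const_mul (-1))
      (fun t => by simpa using norm_indicator_one_le s t) (ih.const_mul (-1))
    convert h1 using 1
    ext t
    by_cases h : t ∈ s <;> simp [h]
  | iUnion f hd hm ih =>
    have hu : ∀ n : ℕ, MeasurableSet (⋃ i ∈ Finset.range n, f i) := fun n =>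
      Finset.measurableSet_biUnion _ fun i _ => hm i
    have hP : ∀ n : ℕ, HasBorelCalculus R
        ((⋃ i ∈ Finset.range n, f i).indicator fun _ => (1 : ℂ)) := by
      intro n
      induction n with
      | zero =>
        have := (HasBorelCalculus.one R).const_mul 0
        simpa using this
      | succ n hn =>
        have h1 := hn.add (measurable_indicator_one (hu n)) (norm_indicator_one_le _)
          (measurable_indicator_one (hm n)) (norm_indicator_one_le _) (ih n)
        convert h1 using 1
        have hdis : Disjoint (⋃ i ∈ Finset.range n, f i) (f n) := by
          rw [Set.disjoint_iUnion₂_left]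
          intro i hi
          exact hd (Finset.mem_range.1 hi).ne
        rw [Finset.range_add_one, Finset.set_biUnion_insert, Set.union_comm,
          Set.indicator_union_of_disjoint hdis]
    refine HasBorelCalculus.limit (K := 1) zero_le_one
      (fun n => measurable_indicator_one (hu n)) (fun n => norm_indicator_one_le _)
      (fun t => ?_) hP
    refine tendsto_const_nhds.congr' ?_
    by_cases h : t ∈ ⋃ i, f i
    · obtain ⟨i, hi⟩ := Set.mem_iUnion.1 h
      filter_upwards [eventually_gt_atTop i] with n hn
      have h2 : t ∈ ⋃ i ∈ Finset.range n, f i :=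
        Set.mem_biUnion (Finset.mem_coe.2 (Finset.mem_range.2 hn)) hi
      rw [Set.indicator_of_mem h, Set.indicator_of_mem h2]
    · refine Eventually.of_forall fun n => ?_
      have h2 : t ∉ ⋃ i ∈ Finset.range n, f i := fun h3 =>
        h (Set.iUnion₂_subset (fun i _ => Set.subset_iUnion f i) h3)
      simp only [Set.indicator_of_notMem h, Set.indicator_of_notMem h2]

theorem HasBorelCalculus.simpleFunc (R : H →L[ℂ] H) (f : SimpleFunc ℝ ℂ) :
    HasBorelCalculus R f := by
  induction f using SimpleFunc.induction with
  | @const c s hs =>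
    have h1 := (HasBorelCalculus.indicator R hs).const_mul c
    convert h1 using 1
    ext t
    by_cases h : t ∈ s <;> simp [h]
  | @add f g _ hf hg =>
    obtain ⟨K, hK⟩ := f.exists_forall_norm_le
    obtain ⟨L, hL⟩ := g.exists_forall_norm_le
    exact hf.add f.measurable hK g.measurable hL hg

/-- Every bounded self-adjoint operator has a bounded Borel functional calculus. -/
theorem hasBorelCalculus (R : H →L[ℂ] H) {f : ℝ → ℂ} (hf : Measurable f) {K : ℝ}
    (hb : ∀ t, ‖f t‖ ≤ K) : HasBorelCalculus R f := by
  have hK : 0 ≤ K := (norm_nonneg _).trans (hb 0)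
  have hs := hf.stronglyMeasurable
  exact HasBorelCalculus.limit hK (fun n => (hs.approxBounded K n).measurable)
    (fun n t => hs.norm_approxBounded_le hK n t)
    (fun t => hs.tendsto_approxBounded_of_norm_le (hb t))
    (fun n => HasBorelCalculus.simpleFunc R _)

end BorelCalculus

section AlgebraicStates

/-- A bounded Borel function on the real line. -/
abbrev BoundedBorel : Type := {f : ℝ → ℂ // Measurable f ∧ ∃ K : ℝ, ∀ t, ‖f t‖ ≤ K}

section Hilbert

variable {H : Type*} [NormedAddCommGroup H] [InnerProductSpace ℂ H] [CompleteSpace H]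

theorem measurable_comp_sqrt_inv (f : BoundedBorel) :
    Measurable fun r : ℝ => f.1 (√(r⁻¹ - 1)) :=
  f.2.1.comp ((measurable_inv.sub_const 1).sqrt)

/-- The bounded function `f(S)` of a positive self-adjoint operator `S`. With `R = (1 + S²)⁻¹`, an
injective bounded operator with spectrum in `[0, 1]`, one has `S = h(R)` for `h(r) = √(1/r - 1)`,
and `f(S) = (f ∘ h)(R)`. -/
noncomputable def boundedFunction (S : H →ₗ.[ℂ] H) (f : BoundedBorel) : H →L[ℂ] H :=
  (hasBorelCalculus (resolventSq S) (measurable_comp_sqrt_inv f)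
    (fun _ => f.2.2.choose_spec _)).choose

/-- The unbounded operator `T` is affiliated to the von Neumann algebra `M`: every bounded operator
in the commutant of `M` maps the domain of `T` to itself and commutes with `T` there. -/
def IsAffiliatedTo (T : H →ₗ.[ℂ] H) (M : VonNeumannAlgebra H) : Prop :=
  ∀ B ∈ M.commutant, ∀ x y : H, (x, y) ∈ T.graph → (B x, B y) ∈ T.graph

/-- The intersection of a set of von Neumann algebras. -/
noncomputable def interVonNeumann (s : Set (VonNeumannAlgebra H)) : VonNeumannAlgebra H where
  toStarSubalgebra := sInf (VonNeumannAlgebra.toStarSubalgebra '' s)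
  centralizer_centralizer' := by
    apply Set.Subset.antisymm
    · intro x hx
      change x ∈ ((sInf (VonNeumannAlgebra.toStarSubalgebra '' s) : StarSubalgebra ℂ (H →L[ℂ] H)) :
        Set (H →L[ℂ] H))
      rw [StarSubalgebra.coe_sInf]
      simp only [Set.mem_image, Set.iInter_exists, Set.biInter_and', Set.iInter_iInter_eq_right,
        Set.mem_iInter]
      intro M hM
      change x ∈ (M : Set (H →L[ℂ] H))
      rw [← M.centralizer_centralizer]
      refine Set.centralizer_subset (Set.centralizer_subset ?_) hx
      intro y hy
      exact (StarSubalgebra.mem_sInf.1 hy) _ ⟨M, hM, rfl⟩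
    · exact Set.subset_centralizer_centralizer

/-- `M` is a factor: its center consists of the multiples of the identity. -/
def IsFactor (M : VonNeumannAlgebra H) : Prop :=
  ∀ z ∈ M, z ∈ M.commutant → ∃ c : ℂ, z = c • (1 : H →L[ℂ] H)

/-- `B` has a trace, equal to `t`: in every orthonormal basis the diagonal of `B` sums to `t`. -/
def HasTrace (B : H →L[ℂ] H) (t : ℂ) : Prop :=
  ∀ (s : Set H) (b : HilbertBasis s ℂ H), HasSum (fun i => ⟪b i, B (b i)⟫_ℂ) t

/-- `ρ` is a density matrix: a positive trace-class operator of trace one. -/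
def IsDensityMatrix (ρ : H →L[ℂ] H) : Prop := ρ.IsPositive ∧ HasTrace ρ 1

end Hilbert

/-- A state on a unital `*`-algebra: a positive normalized linear functional. -/
structure AlgState (A : Type*) [Ring A] [Algebra ℂ A] [StarRing A] where
  /-- The linear functional. -/
  toFun : A →ₗ[ℂ] ℂ
  re_nonneg : ∀ a, 0 ≤ (toFun (star a * a)).re
  im_eq_zero : ∀ a, (toFun (star a * a)).im = 0
  map_one : toFun 1 = 1

namespace AlgState

variable {A : Type*} [Ring A] [Algebra ℂ A] [StarRing A] [StarModule ℂ A]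

theorem conj_symm (ω : AlgState A) (a b : A) :
    starRingEnd ℂ (ω.toFun (star b * a)) = ω.toFun (star a * b) := by
  have h1 := ω.im_eq_zero (a + b)
  have h2 := ω.im_eq_zero (a + Complex.I • b)
  have ha := ω.im_eq_zero a
  have hb := ω.im_eq_zero b
  simp only [star_add, star_smul, add_mul, mul_add, map_add, smul_mul_assoc, mul_smul_comm,
    map_smul, smul_eq_mul, Complex.star_def, Complex.conj_I, Complex.add_im, Complex.mul_im,
    Complex.mul_re, Complex.I_re, Complex.I_im, Complex.neg_re, Complex.neg_im] at h1 h2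
  apply Complex.ext
  · rw [Complex.conj_re]; linarith
  · rw [Complex.conj_im]; linarith

/-- The algebra `A`, as the pre-Hilbert space with inner product `⟨a, b⟩ = ω(a* b)`. -/
@[nolint unusedArguments]
def PreGNS (_ω : AlgState A) : Type _ := A

instance (ω : AlgState A) : AddCommGroup ω.PreGNS := inferInstanceAs (AddCommGroup A)
instance (ω : AlgState A) : Module ℂ ω.PreGNS := inferInstanceAs (Module ℂ A)

/-- The identity map from `A` to its pre-Hilbert space. -/
def toPreGNS (ω : AlgState A) : A ≃ₗ[ℂ] ω.PreGNS := LinearEquiv.refl ℂ A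

/-- The inner product `⟨a, b⟩ = ω(a* b)`. -/
noncomputable abbrev preGNSCore (ω : AlgState A) : PreInnerProductSpace.Core ℂ ω.PreGNS where
  inner a b := ω.toFun (star (ω.toPreGNS.symm a) * ω.toPreGNS.symm b)
  conj_inner_symm a b := ω.conj_symm _ _
  re_inner_nonneg a := ω.re_nonneg _
  add_left a b c := by rw [map_add, star_add, add_mul, map_add]
  smul_left a b c := by simp

noncomputable instance (ω : AlgState A) : SeminormedAddCommGroup ω.PreGNS :=
  InnerProductSpace.Core.toSeminormedAddCommGroup (c := ω.preGNSCore)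

noncomputable instance (ω : AlgState A) : InnerProductSpace ℂ ω.PreGNS :=
  InnerProductSpace.ofCore ω.preGNSCore

/-- The GNS Hilbert space of `ω`. -/
abbrev GNS (ω : AlgState A) : Type _ := UniformSpace.Completion ω.PreGNS

/-- The map `a ↦ |a ω⟩` from `A` to the GNS Hilbert space. -/
noncomputable def vec (ω : AlgState A) : A →ₗ[ℂ] ω.GNS :=
  (UniformSpace.Completion.toComplₗᵢ (𝕜 := ℂ) (E := ω.PreGNS)).toLinearMap ∘ₗ
    ω.toPreGNS.toLinearMap

theorem inner_vec (ω : AlgState A) (a b : A) :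
    ⟪ω.vec a, ω.vec b⟫_ℂ = ω.toFun (star a * b) :=
  UniformSpace.Completion.inner_coe _ _

theorem dense_range_vec (ω : AlgState A) : Dense (Set.range ω.vec) :=
  UniformSpace.Completion.denseRange_coe.comp ω.toPreGNS.surjective.denseRange
    (UniformSpace.Completion.continuous_coe _)

/-- The graph of the operator `|b ω⟩ ↦ |(a b) ω⟩` on the GNS domain `{|b ω⟩}`. -/
noncomputable def preFieldGraph (ω : AlgState A) (a : A) : Submodule ℂ (ω.GNS × ω.GNS) :=
  LinearMap.range (ω.vec.prod (ω.vec ∘ₗ LinearMap.mulLeft ℂ a))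

/-- The closed operator on the GNS Hilbert space representing `a`: the closure of the operator
`|b ω⟩ ↦ |(a b) ω⟩` with domain `{|b ω⟩}`. -/
noncomputable def fieldOperator (ω : AlgState A) (a : A) : ω.GNS →ₗ.[ℂ] ω.GNS :=
  (ω.preFieldGraph a).topologicalClosure.toLinearPMap

theorem inner_of_mem_closure (ω : AlgState A) (a : A) (p : ω.GNS × ω.GNS)
    (hp : p ∈ (ω.preFieldGraph a).topologicalClosure) (c : A) :
    ⟪ω.vec c, p.2⟫_ℂ = ⟪ω.vec (star a * c), p.1⟫_ℂ := by
  have hcl : IsClosed {p : ω.GNS × ω.GNS | ⟪ω.vec c, p.2⟫_ℂ = ⟪ω.vec (star a * c), p.1⟫_ℂ} :=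
    isClosed_eq (by fun_prop) (by fun_prop)
  refine closure_minimal (t := {p : ω.GNS × ω.GNS |
    ⟪ω.vec c, p.2⟫_ℂ = ⟪ω.vec (star a * c), p.1⟫_ℂ}) ?_ hcl hp
  rintro _ ⟨b, rfl⟩
  change ⟪ω.vec c, ω.vec (a * b)⟫_ℂ = ⟪ω.vec (star a * c), ω.vec b⟫_ℂ
  rw [inner_vec, inner_vec, star_mul, star_star, mul_assoc]

theorem graph_fieldOperator (ω : AlgState A) (a : A) :
    (ω.fieldOperator a).graph = (ω.preFieldGraph a).topologicalClosure := by
  apply Submodule.toLinearPMap_graph_eq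
  intro p hp hp1
  refine ω.dense_range_vec.eq_zero_of_inner_right (𝕜 := ℂ) ?_
  rintro _ ⟨c, rfl⟩
  rw [ω.inner_of_mem_closure a p hp c, hp1, inner_zero_right]

theorem isClosed_fieldOperator (ω : AlgState A) (a : A) : (ω.fieldOperator a).IsClosed := by
  rw [LinearPMap.IsClosed, graph_fieldOperator]
  exact Submodule.isClosed_topologicalClosure _

theorem dense_domain_fieldOperator (ω : AlgState A) (a : A) :
    Dense ((ω.fieldOperator a).domain : Set ω.GNS) := by
  refine ω.dense_range_vec.mono ?_
  rintro _ ⟨b, rfl⟩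
  exact ⟨(ω.vec b, ω.vec (a * b)), Submodule.le_topologicalClosure _ ⟨b, rfl⟩, rfl⟩

/-- The von Neumann algebra `A_ω`: the smallest von Neumann algebra on the GNS Hilbert space to
which all elements of `A` are affiliated. -/
noncomputable def vonNeumannAlgebra (ω : AlgState A) : VonNeumannAlgebra ω.GNS :=
  interVonNeumann {M | ∀ a, IsAffiliatedTo (ω.fieldOperator a) M}

/-- The state `ω` is factorial: `A_ω` is a factor. -/
def IsFactorial (ω : AlgState A) : Prop := IsFactor ω.vonNeumannAlgebra

/-- The partial isometry `u_a` in the polar decomposition `a = u_a |a|` on the GNS space. -/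
noncomputable def phase (ω : AlgState A) (a : A) : ω.GNS →L[ℂ] ω.GNS :=
  (exists_polarDecomposition _ (ω.isClosed_fieldOperator a)
    (ω.dense_domain_fieldOperator a)).choose

/-- The positive operator `|a|` in the polar decomposition `a = u_a |a|` on the GNS space. -/
noncomputable def absValue (ω : AlgState A) (a : A) : ω.GNS →ₗ.[ℂ] ω.GNS :=
  (exists_polarDecomposition _ (ω.isClosed_fieldOperator a)
    (ω.dense_domain_fieldOperator a)).choose_spec.choose

theorem isPolarDecomposition (ω : AlgState A) (a : A) :
    IsPolarDecomposition (ω.fieldOperator a) (ω.phase a) (ω.absValue a) :=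
  (exists_polarDecomposition _ (ω.isClosed_fieldOperator a)
    (ω.dense_domain_fieldOperator a)).choose_spec.choose_spec

end AlgState

/-- The symbols `u_a`, `u_a†` and `f(|a|)`, for `a ∈ A` and `f` bounded. -/
inductive FieldSymbol (A : Type*) : Type _
  | phase (a : A)
  | phaseAdjoint (a : A)
  | boundedAbs (a : A) (f : BoundedBorel)

namespace AlgState

variable {A : Type*} [Ring A] [Algebra ℂ A] [StarRing A] [StarModule ℂ A]

/-- The bounded operator on the GNS space of `ω` denoted by a symbol. -/
noncomputable def symbolOp (ω : AlgState A) : FieldSymbol A → (ω.GNS →L[ℂ] ω.GNS)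
  | .phase a => ω.phase a
  | .phaseAdjoint a => (ω.phase a).adjoint
  | .boundedAbs a f => boundedFunction (ω.absValue a) f

/-- The bounded operator on the GNS space of `ω` denoted by a finite product of symbols. -/
noncomputable def wordOp (ω : AlgState A) (w : List (FieldSymbol A)) : ω.GNS →L[ℂ] ω.GNS :=
  (w.map ω.symbolOp).prod

/-- `ω₂` can be excited out of `ω₁`, written `ω₂ ≺ ω₁`: there is a density matrix `ρ` on the GNS
space of `ω₁` with `tr (ρ w⁽¹⁾) = ⟨ω₂, w⁽²⁾ ω₂⟩` for every finite product `w` of symbols `u_a`,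
`u_a†`, `f(|a|)`, where `w⁽ⁱ⁾` is the operator denoted by `w` on the GNS space of `ωᵢ`. -/
def ExcitableFrom (ω₂ ω₁ : AlgState A) : Prop :=
  ∃ ρ : ω₁.GNS →L[ℂ] ω₁.GNS, IsDensityMatrix ρ ∧
    ∀ w : List (FieldSymbol A),
      HasTrace (ρ ∘L ω₁.wordOp w) ⟪ω₂.vec 1, ω₂.wordOp w (ω₂.vec 1)⟫_ℂ

end AlgState

end AlgebraicStates

/-! The relation `ω₂ ≺ ω₁` amounts to a comparison of the GNS spaces by intertwiners, that is,
bounded maps commuting with every symbol `u_a`, `u_a†`, `f(|a|)`; factoriality makes the comparison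
reversible.

Write `ρ = ∑ |ζₖ⟩⟨ζₖ|`. The hypothesis says that the vector state of `|ω₂⟩` on words is the sum of
the vector functionals of the `ζₖ`. Hence a combination of words applied to `|ω₂⟩` dominates in norm
the same combination applied to `ζₖ`, and `w|ω₂⟩ ↦ w ζₖ` extends to an intertwiner
(`exists_intertwiner`). Some `ζₖ` is nonzero, so the adjoint is a nonzero intertwiner from the space
of `ω₁` to that of `ω₂`.

The common kernel of all intertwiners in that direction is invariant under the symbols and under
their commutant, so its projection is central in `A_ω₁`. As `A_ω₁` is a factor, the kernel is zero
and the intertwiners separate points (`IsFactorial.separating`). Polar decomposition and Zorn's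
lemma then yield partially isometric intertwiners `V` with `∑ V†V = 1`
(`exists_separating_partialIsometries`, `hasSum_adjoint_comp_self`). Thus `⟨ω₁, w ω₁⟩ = ∑ ⟨V ω₁, w V
ω₁⟩`, and `∑ |V ω₁⟩⟨V ω₁|` is the density matrix sought.

The remaining work links words to `A_ω`, which is defined by affiliation of unbounded operators: an
operator commutes with all symbols exactly when it and its adjoint preserve the graphs of all fields
(`symbolOp_commute`, `fieldOperator_graph_invariant`). -/

/-! ### Density matrices as square-summable families of vectors. -/

section Trace

variable {H : Type*} [NormedAddCommGroup H] [InnerProductSpace ℂ H] [CompleteSpace H]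

theorem HilbertBasis.hasSum_norm_inner_sq {ι : Type*} (b : HilbertBasis ι ℂ H) (x : H) :
    HasSum (fun i => ‖⟪b i, x⟫_ℂ‖ ^ 2) (‖x‖ ^ 2) := by
  have h := b.hasSum_inner_mul_inner x x
  have h1 : ∀ i, ⟪x, b i⟫_ℂ * ⟪b i, x⟫_ℂ = ((‖⟪b i, x⟫_ℂ‖ ^ 2 : ℝ) : ℂ) := fun i => by
    rw [← inner_conj_symm, Complex.conj_mul']
    push_cast
    rfl
  simp only [h1, inner_self_eq_norm_sq_to_K] at h
  have h2 := Complex.hasSum_re h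
  simp only [Complex.ofReal_re] at h2
  convert h2 using 1
  norm_cast

/-- Parseval in one variable, then Tonelli. It provides the absolute convergence needed to exchange
the sum over `k` with the sum over a basis. -/
theorem HilbertBasis.summable_norm_inner_sq_prod {ι κ : Type*} (b : HilbertBasis ι ℂ H) {ζ : κ → H}
    (hζ : Summable fun k => ‖ζ k‖ ^ 2) :
    Summable fun p : κ × ι => ‖⟪b p.2, ζ p.1⟫_ℂ‖ ^ 2 := by
  rw [summable_prod_of_nonneg (fun _ => by positivity)]
  refine ⟨fun k => (b.hasSum_norm_inner_sq (ζ k)).summable, ?_⟩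
  simpa only [(b.hasSum_norm_inner_sq _).tsum_eq] using hζ

theorem summable_inner_apply {κ : Type*} {ζ : κ → H} (hζ : Summable fun k => ‖ζ k‖ ^ 2)
    (C : H →L[ℂ] H) : Summable fun k => ⟪ζ k, C (ζ k)⟫_ℂ := by
  refine Summable.of_norm_bounded (hζ.mul_left ‖C‖) fun k => ?_
  calc ‖⟪ζ k, C (ζ k)⟫_ℂ‖ ≤ ‖ζ k‖ * ‖C (ζ k)‖ := norm_inner_le_norm _ _
    _ ≤ ‖ζ k‖ * (‖C‖ * ‖ζ k‖) := by gcongr; exact C.le_opNorm _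
    _ = ‖C‖ * ‖ζ k‖ ^ 2 := by ring

/-- The trace of `ρ C`, for `ρ = ∑ |ζₖ⟩⟨ζₖ|`, is the sum of the expectations `⟨ζₖ, C ζₖ⟩`. -/
theorem hasTrace_comp_of_hasSum {κ : Type*} {ζ : κ → H} (hζ : Summable fun k => ‖ζ k‖ ^ 2)
    {ρ : H →L[ℂ] H} (hρ : ∀ x y, HasSum (fun k => ⟪x, ζ k⟫_ℂ * ⟪ζ k, y⟫_ℂ) ⟪x, ρ y⟫_ℂ)
    (C : H →L[ℂ] H) {t : ℂ} (ht : HasSum (fun k => ⟪ζ k, C (ζ k)⟫_ℂ) t) :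
    HasTrace (ρ ∘L C) t := by
  intro s b
  have hζ' : Summable fun k => ‖C.adjoint (ζ k)‖ ^ 2 := by
    refine Summable.of_nonneg_of_le (fun _ => by positivity) (fun k => ?_)
      (hζ.mul_left (‖C.adjoint‖ ^ 2))
    rw [← mul_pow]
    exact pow_le_pow_left₀ (norm_nonneg _) (C.adjoint.le_opNorm _) 2
  -- By `2ab ≤ a² + b²` the double series is dominated by those of `ζ` and `C†ζ`. Summing over the
  -- basis first gives `∑ ⟨ζₖ, C ζₖ⟩`; summing over `k` first gives the diagonal of `ρ C`.
  have hF : Summable fun p : κ × s => ⟪b p.2, ζ p.1⟫_ℂ * ⟪ζ p.1, C (b p.2)⟫_ℂ := by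
    have hsum := (b.summable_norm_inner_sq_prod hζ).add (b.summable_norm_inner_sq_prod hζ')
    refine Summable.of_norm_bounded hsum fun p => ?_
    rw [norm_mul, ← ContinuousLinearMap.adjoint_inner_left C, norm_inner_symm (C.adjoint _)]
    have := two_mul_le_add_sq ‖⟪b p.2, ζ p.1⟫_ℂ‖ ‖⟪b p.2, C.adjoint (ζ p.1)⟫_ℂ‖
    have := mul_nonneg (norm_nonneg ⟪b p.2, ζ p.1⟫_ℂ) (norm_nonneg ⟪b p.2, C.adjoint (ζ p.1)⟫_ℂ)
    linarith
  obtain ⟨t', ht'⟩ := hF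
  have h1 : HasSum (fun k => ⟪ζ k, C (ζ k)⟫_ℂ) t' := by
    refine ht'.prod_fiberwise fun k => ?_
    have h2 := b.hasSum_inner_mul_inner (C.adjoint (ζ k)) (ζ k)
    simp only [ContinuousLinearMap.adjoint_inner_left] at h2
    simpa only [mul_comm] using h2
  obtain rfl := ht.unique h1
  have h3 : HasSum (fun p : s × κ => ⟪b p.1, ζ p.2⟫_ℂ * ⟪ζ p.2, C (b p.1)⟫_ℂ) t :=
    (Equiv.prodComm s κ).hasSum_iff.2 ht'
  exact h3.prod_fiberwise fun i => hρ (b i) (C (b i))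

/-- The operator `∑ |ζₖ⟩⟨ζₖ|` of a square-summable family is positive and bounded. -/
theorem exists_isPositive_hasSum {κ : Type*} {ζ : κ → H} (hζ : Summable fun k => ‖ζ k‖ ^ 2) :
    ∃ ρ : H →L[ℂ] H, ρ.IsPositive ∧
      ∀ x y, HasSum (fun k => ⟪x, ζ k⟫_ℂ * ⟪ζ k, y⟫_ℂ) ⟪x, ρ y⟫_ℂ := by
  have hs : Summable fun k => InnerProductSpace.rankOne ℂ (ζ k) (ζ k) := by
    refine Summable.of_norm_bounded hζ fun k => ?_
    rw [InnerProductSpace.norm_rankOne, sq]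
  obtain ⟨ρ, hρ⟩ := hs
  have h1 : ∀ x y, HasSum (fun k => ⟪x, ζ k⟫_ℂ * ⟪ζ k, y⟫_ℂ) ⟪x, ρ y⟫_ℂ := fun x y => by
    have h2 := hρ.mapL (innerSL ℂ x ∘L ContinuousLinearMap.apply ℂ H y)
    simpa [inner_smul_right, mul_comm] using h2
  refine ⟨ρ, ?_, h1⟩
  rw [ContinuousLinearMap.isPositive_iff_complex]
  intro x
  have h2 := h1 x x
  have h3 : ∀ k, ⟪x, ζ k⟫_ℂ * ⟪ζ k, x⟫_ℂ = ((‖⟪ζ k, x⟫_ℂ‖ ^ 2 : ℝ) : ℂ) := fun k => by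
    rw [← inner_conj_symm, Complex.conj_mul']
    push_cast
    rfl
  simp only [h3] at h2
  have h4 : (⟪x, ρ x⟫_ℂ) = ((∑' k, ‖⟪ζ k, x⟫_ℂ‖ ^ 2 : ℝ) : ℂ) := by
    rw [Complex.ofReal_tsum]
    exact h2.tsum_eq.symm
  rw [← inner_conj_symm, h4]
  simp only [Complex.conj_ofReal]
  exact ⟨rfl, tsum_nonneg fun _ => by positivity⟩

/-- A density matrix is a mixture of vector states. -/
theorem IsDensityMatrix.exists_vectors {ρ : H →L[ℂ] H} (hρ : IsDensityMatrix ρ) :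
    ∃ (s : Set H) (ζ : s → H), HasSum (fun k => ‖ζ k‖ ^ 2) 1 ∧
      ∀ (C : H →L[ℂ] H) (t : ℂ), HasTrace (ρ ∘L C) t → HasSum (fun k => ⟪ζ k, C (ζ k)⟫_ℂ) t := by
  obtain ⟨hpos, htr⟩ := hρ
  obtain ⟨s, b, -⟩ := exists_hilbertBasis ℂ H
  have h0 : 0 ≤ ρ := (ContinuousLinearMap.nonneg_iff_isPositive _).2 hpos
  have hS0 : 0 ≤ CFC.sqrt ρ := CFC.sqrt_nonneg _
  have hSS : CFC.sqrt ρ * CFC.sqrt ρ = ρ := CFC.sqrt_mul_sqrt_self ρ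
  set S := CFC.sqrt ρ
  have hSSx : ∀ x, S (S x) = ρ x := fun x => DFunLike.congr_fun hSS x
  have hSs : ∀ x y, ⟪S x, y⟫_ℂ = ⟪x, S y⟫_ℂ := fun x y =>
    ((ContinuousLinearMap.nonneg_iff_isPositive _).1 hS0).inner_left_eq_inner_right x y
  -- The vectors are `ζₖ = √ρ bₖ` for a fixed basis `b`, so that `‖ζₖ‖² = ⟨bₖ, ρ bₖ⟩`.
  have h1 : HasSum (fun k => ‖S (b k)‖ ^ 2) 1 := by
    have h2 := Complex.hasSum_re (htr s b)
    rw [Complex.one_re] at h2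
    have h4 : ∀ k, ‖S (b k)‖ ^ 2 = (⟪b k, ρ (b k)⟫_ℂ).re := by
      intro k
      rw [← inner_self_eq_norm_sq (𝕜 := ℂ), hSs, hSSx]
      rfl
    simpa only [h4] using h2
  have h3 : ∀ x y, HasSum (fun k => ⟪x, S (b k)⟫_ℂ * ⟪S (b k), y⟫_ℂ) ⟪x, ρ y⟫_ℂ := fun x y => by
    simpa only [hSs, hSSx] using b.hasSum_inner_mul_inner (S x) (S y)
  refine ⟨s, fun k => S (b k), h1, fun C t ht => ?_⟩
  -- The sum of expectations exists; it equals `t` because both are the diagonal sum of `ρ C` in the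
  -- basis `b`.
  obtain ⟨t', ht'⟩ := summable_inner_apply h1.summable C
  rwa [(ht s b).unique (hasTrace_comp_of_hasSum h1.summable h3 C ht' s b)]

end Trace

/-! ### Intertwiners between two families of operators closed under adjoints. -/

section Intertwiners

variable {H K : Type*} [NormedAddCommGroup H] [InnerProductSpace ℂ H] [CompleteSpace H]
  [NormedAddCommGroup K] [InnerProductSpace ℂ K] [CompleteSpace K]

/-- Bounded maps agreeing on the range of `N` and on its orthogonal complement are equal. -/
theorem ContinuousLinearMap.ext_of_range_of_orthogonal {L : Type*} [AddCommGroup L]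
    [Module ℂ L] (N : L →ₗ[ℂ] H) {F G : H →L[ℂ] K} (h1 : ∀ z, F (N z) = G (N z))
    (h2 : ∀ v, (∀ z, ⟪N z, v⟫_ℂ = 0) → F v = G v) : F = G := by
  let R := (LinearMap.range N).topologicalClosure
  have : CompleteSpace R := (Submodule.isClosed_topologicalClosure _).completeSpace_coe
  have hR : ∀ x ∈ R, F x = G x := by
    have hcl : IsClosed {x | F x = G x} := isClosed_eq F.continuous G.continuous
    refine closure_minimal (t := {x | F x = G x}) ?_ hcl
    rintro _ ⟨z, rfl⟩
    exact h1 z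
  have hR' : ∀ x ∈ Rᗮ, F x = G x := fun x hx =>
    h2 x fun z => hx _ (Submodule.le_topologicalClosure _ ⟨z, rfl⟩)
  ext x
  obtain ⟨y, hy, z, hz, rfl⟩ := R.exists_add_mem_mem_orthogonal x
  rw [map_add, map_add, hR y hy, hR' z hz]

/-- A bounded operator leaving a closed subspace and its complement invariant commutes with the
orthogonal projection. -/
theorem Submodule.starProjection_comm (R : Submodule ℂ H) [R.HasOrthogonalProjection]
    (B : H →L[ℂ] H) (h1 : ∀ x ∈ R, B x ∈ R) (h2 : ∀ x ∈ R, B.adjoint x ∈ R) (x : H) :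
    R.starProjection (B x) = B (R.starProjection x) := by
  refine R.eq_starProjection_of_mem_of_inner_eq_zero (h1 _ (R.starProjection_apply_mem x))
    fun w hw => ?_
  rw [← map_sub, ← ContinuousLinearMap.adjoint_inner_right]
  exact R.starProjection_inner_eq_zero _ _ (h2 w hw)

/-- A linear map dominated by `E` factors through a bounded operator vanishing on the orthogonal
complement of the range of `E`. -/
theorem exists_extension_of_norm_le {M : Type*} [AddCommGroup M] [Module ℂ M] (E : M →ₗ[ℂ] H)
    (F : M →ₗ[ℂ] K) (h : ∀ m, ‖F m‖ ≤ ‖E m‖) :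
    ∃ X : H →L[ℂ] K, (∀ m, X (E m) = F m) ∧ ∀ v, (∀ m, ⟪E m, v⟫_ℂ = 0) → X v = 0 := by
  let R := (LinearMap.range E).topologicalClosure
  have : CompleteSpace R := (Submodule.isClosed_topologicalClosure _).completeSpace_coe
  have hmem : ∀ m, E m ∈ R := fun m => Submodule.le_topologicalClosure _ ⟨m, rfl⟩
  let e : M →ₗ[ℂ] R := E.codRestrict R hmem
  have hde : DenseRange e := by
    intro y
    have hy : (y : H) ∈ closure (Set.range E) := y.2
    rw [Metric.mem_closure_iff] at hy ⊢
    intro ε hε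
    obtain ⟨_, ⟨z, rfl⟩, hz⟩ := hy ε hε
    exact ⟨e z, ⟨z, rfl⟩, hz⟩
  refine ⟨F.extendOfNorm e ∘L R.orthogonalProjectionOnto, fun m => ?_, fun v hv => ?_⟩
  · have h1 : R.orthogonalProjectionOnto (E m) = e m :=
      Submodule.orthogonalProjectionOnto_mem_subspace_eq_self (e m)
    rw [ContinuousLinearMap.comp_apply, h1]
    exact LinearMap.extendOfNorm_eq hde ⟨1, fun x => (one_mul ‖e x‖).symm ▸ h x⟩ m
  · have : v ∈ Rᗮ := by
      rw [Submodule.orthogonal_closure]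
      rintro _ ⟨z, rfl⟩
      exact hv z
    simp [Submodule.orthogonalProjectionOnto_eq_zero_iff.2 this]

/-- An operator of the same norm on every vector factors through a partial isometry. -/
theorem exists_partialIsometry_of_norm_eq (N : H →L[ℂ] H) (Y : H →L[ℂ] K)
    (h : ∀ z, ‖Y z‖ = ‖N z‖) :
    ∃ W : H →L[ℂ] K, (∀ z, W (N z) = Y z) ∧ (∀ v, (∀ z, ⟪N z, v⟫_ℂ = 0) → W v = 0) ∧
      W ∘L W.adjoint ∘L W = W := by
  obtain ⟨W, hW, hW0⟩ := exists_extension_of_norm_le N.toLinearMap Y.toLinearMap fun z => (h z).le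
  have hWN : ∀ z, W (N z) = Y z := hW
  refine ⟨W, hW, hW0, ContinuousLinearMap.ext_of_range_of_orthogonal N.toLinearMap
    (fun z => ?_) fun v hv => ?_⟩
  · change W (W.adjoint (W (N z))) = W (N z)
    -- `W†W N z - N z` is orthogonal to the range of `N`, because `N†N = Y†Y`, so `W` kills it.
    rw [← sub_eq_zero, ← map_sub]
    refine hW0 _ fun y => ?_
    change ⟪N y, W.adjoint (W (N z)) - N z⟫_ℂ = 0
    have h1 : N.adjoint ∘L N = Y.adjoint ∘L Y := by
      apply ContinuousLinearMap.coe_inj.1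
      refine (ext_inner_map _ _).1 fun x => ?_
      change ⟪N.adjoint (N x), x⟫_ℂ = ⟪Y.adjoint (Y x), x⟫_ℂ
      rw [ContinuousLinearMap.adjoint_inner_left, ContinuousLinearMap.adjoint_inner_left,
        inner_self_eq_norm_sq_to_K, inner_self_eq_norm_sq_to_K, h]
    have h2 : N.adjoint (N z) = Y.adjoint (Y z) := DFunLike.congr_fun h1 z
    rw [inner_sub_right, ContinuousLinearMap.adjoint_inner_right, hWN, hWN,
      ← ContinuousLinearMap.adjoint_inner_right Y, ← ContinuousLinearMap.adjoint_inner_right N, h2,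
      sub_self]
  · change W (W.adjoint (W v)) = W v
    rw [hW0 v hv, map_zero, map_zero]

variable {ι : Type*} {s : ι → H →L[ℂ] H} {t : ι → K →L[ℂ] K} {σ : ι → ι}

/-- The bounded map `X` intertwines the families of operators `s` and `t`. -/
def Intertwines (s : ι → H →L[ℂ] H) (t : ι → K →L[ℂ] K) (X : H →L[ℂ] K) : Prop :=
  ∀ i x, X (s i x) = t i (X x)

theorem Intertwines.list_prod {X : H →L[ℂ] K} (hX : Intertwines s t X) (w : List ι) (x : H) :
    X ((w.map s).prod x) = (w.map t).prod (X x) := by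
  induction w with
  | nil => rfl
  | cons i w ih =>
    simp only [List.map_cons, List.prod_cons]
    change X (s i ((w.map s).prod x)) = t i ((w.map t).prod (X x))
    rw [hX, ih]

/-- The map `σ` records that both families are closed under adjoints in the same way. This is what
lets an intertwiner be reversed. -/
theorem Intertwines.adjoint (hs : ∀ i, (s i).adjoint = s (σ i)) (ht : ∀ i, (t i).adjoint = t (σ i))
    {X : H →L[ℂ] K} (hX : Intertwines s t X) : Intertwines t s X.adjoint := by
  intro i y
  refine ext_inner_right ℂ fun x => ?_
  rw [ContinuousLinearMap.adjoint_inner_left, ← ContinuousLinearMap.adjoint_inner_right (s i),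
    ContinuousLinearMap.adjoint_inner_left, hs, hX, ← ht, ContinuousLinearMap.adjoint_inner_right]

theorem Intertwines.starProjection (hs : ∀ i, (s i).adjoint = s (σ i)) (R : Submodule ℂ H)
    [R.HasOrthogonalProjection] (hR : ∀ i, ∀ x ∈ R, s i x ∈ R) :
    Intertwines s s R.starProjection := fun i x =>
  R.starProjection_comm (s i) (hR i) (by rw [hs]; exact hR (σ i)) x

theorem Intertwines.comp {L : Type*} [NormedAddCommGroup L] [InnerProductSpace ℂ L]
    [CompleteSpace L] {r : ι → L →L[ℂ] L} {X : H →L[ℂ] K} {Y : L →L[ℂ] H}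
    (hX : Intertwines s t X) (hY : Intertwines r s Y) : Intertwines r t (X ∘L Y) := fun i x => by
  change X (Y (r i x)) = t i (X (Y x))
  rw [hY, hX]

/-- The partial isometry in the polar decomposition of an intertwiner is an intertwiner. -/
theorem Intertwines.exists_partialIsometry (hs : ∀ i, (s i).adjoint = s (σ i))
    (ht : ∀ i, (t i).adjoint = t (σ i)) {Y : H →L[ℂ] K} (hY : Intertwines s t Y) :
    ∃ W : H →L[ℂ] K, Intertwines s t W ∧ W ∘L W.adjoint ∘L W = W ∧
      (∀ x, Y x = 0 → W x = 0) ∧ (W = 0 → Y = 0) := by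
  have h0 : 0 ≤ Y.adjoint ∘L Y := by
    rw [ContinuousLinearMap.nonneg_iff_isPositive]
    exact ContinuousLinearMap.isPositive_adjoint_comp_self Y
  have hN0 : 0 ≤ CFC.sqrt (Y.adjoint ∘L Y) := CFC.sqrt_nonneg _
  have hNN : CFC.sqrt (Y.adjoint ∘L Y) * CFC.sqrt (Y.adjoint ∘L Y) = Y.adjoint ∘L Y :=
    CFC.sqrt_mul_sqrt_self _
  -- `Y†Y` intertwines `s` with itself, hence so does its square root `|Y|`; the partial isometry
  -- `|Y| z ↦ Y z` inherits the intertwining property.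
  have hNc : ∀ i, Commute (CFC.sqrt (Y.adjoint ∘L Y)) (s i) := fun i => by
    refine Commute.cfcₙ_nnreal ?_ _
    ext x
    exact ((hY.adjoint hs ht).comp hY) i x
  set N := CFC.sqrt (Y.adjoint ∘L Y)
  have hNs : ∀ x y, ⟪N x, y⟫_ℂ = ⟪x, N y⟫_ℂ := fun x y =>
    ((ContinuousLinearMap.nonneg_iff_isPositive _).1 hN0).inner_left_eq_inner_right x y
  have hNNx : ∀ x, N (N x) = Y.adjoint (Y x) := fun x => DFunLike.congr_fun hNN x
  have hn : ∀ z, ‖Y z‖ = ‖N z‖ := fun z => by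
    rw [← pow_left_inj₀ (norm_nonneg _) (norm_nonneg _) two_ne_zero,
      ← inner_self_eq_norm_sq (𝕜 := ℂ), ← inner_self_eq_norm_sq (𝕜 := ℂ), hNs, hNNx,
      ContinuousLinearMap.adjoint_inner_right]
  obtain ⟨W, hW, hW0, hWW⟩ := exists_partialIsometry_of_norm_eq N Y hn
  refine ⟨W, fun i x => ?_, hWW, fun x hx => hW0 x fun z => ?_, ?_⟩
  · have hNi : ∀ i z, N (s i z) = s i (N z) := fun i z => DFunLike.congr_fun (hNc i).eq z
    refine DFunLike.congr_fun (ContinuousLinearMap.ext_of_range_of_orthogonal N.toLinearMap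
      (F := W ∘L s i) (G := t i ∘L W) (fun z => ?_) fun v hv => ?_) x
    · change W (s i (N z)) = t i (W (N z))
      rw [← hNi, hW, hW, hY]
    · change W (s i v) = t i (W v)
      rw [hW0 v hv, map_zero]
      refine hW0 _ fun z => ?_
      rw [← ContinuousLinearMap.adjoint_inner_left, hs, ← hNi]
      exact hv _
  · have : N x = 0 := by rw [← norm_eq_zero, ← hn, hx, norm_zero]
    rw [hNs, this, inner_zero_right]
  · rintro rfl
    ext z
    rw [← hW]
    rfl

/-- If the intertwiners from `s` to `t` separate points, then there is a family of partially
isometric intertwiners with orthogonal initial spaces, which separates points. -/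
theorem exists_separating_partialIsometries (hs : ∀ i, (s i).adjoint = s (σ i))
    (ht : ∀ i, (t i).adjoint = t (σ i))
    (hsep : ∀ v : H, v ≠ 0 → ∃ X : H →L[ℂ] K, Intertwines s t X ∧ X v ≠ 0) :
    ∃ S : Set (H →L[ℂ] K), (∀ V ∈ S, Intertwines s t V ∧ V ∘L V.adjoint ∘L V = V) ∧
      S.Pairwise (fun V W => W ∘L V.adjoint = 0) ∧ ∀ v, (∀ V ∈ S, V v = 0) → v = 0 := by
  obtain ⟨S, hS⟩ := zorn_subset {S : Set (H →L[ℂ] K) |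
    (∀ V ∈ S, Intertwines s t V ∧ V ∘L V.adjoint ∘L V = V) ∧
      S.Pairwise (fun V W => W ∘L V.adjoint = 0)} (fun c hc hchain => by
    refine ⟨⋃₀ c, ⟨?_, ?_⟩, fun _ => Set.subset_sUnion_of_mem⟩
    · rintro V ⟨S, hS, hV⟩
      exact (hc hS).1 V hV
    · rw [Set.pairwise_sUnion hchain.directedOn]
      exact fun S hS => (hc hS).2)
  refine ⟨S, hS.prop.1, hS.prop.2, fun v hv => ?_⟩
  by_contra hv0
  obtain ⟨X, hX, hXv⟩ := hsep v hv0
  -- The part of `H` not covered by the maximal family. Cutting `X` down to `R` keeps it an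
  -- intertwiner, and its polar part `W` has initial space orthogonal to all earlier ones.
  let R : Submodule ℂ H := ⨅ V : S, LinearMap.ker V.1.toLinearMap
  have hR : ∀ x, x ∈ R ↔ ∀ V ∈ S, V x = 0 := fun x => by simp [R]
  have hRcl : IsClosed (R : Set H) := by
    simp only [R, Submodule.coe_iInf]
    exact isClosed_iInter fun V => V.1.isClosed_ker
  have : CompleteSpace R := hRcl.completeSpace_coe
  have hQ : Intertwines s s R.starProjection := Intertwines.starProjection hs R fun i x hx => by
    rw [hR] at hx ⊢
    intro V hV
    rw [(hS.prop.1 V hV).1, hx V hV, map_zero]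
  obtain ⟨W, hWi, hWW, hW0, hWne⟩ := (hX.comp hQ).exists_partialIsometry hs ht
  have hWV : ∀ V ∈ S, W ∘L V.adjoint = 0 := fun V hV => by
    ext y
    refine hW0 _ ?_
    have : V.adjoint y ∈ Rᗮ := fun r hr => by
      rw [ContinuousLinearMap.adjoint_inner_right, (hR r).1 hr V hV, inner_zero_left]
    change X (R.starProjection _) = 0
    exact (congrArg X (R.starProjection_apply_eq_zero_iff.2 this)).trans (map_zero X)
  have hWmem : W ∈ S := by
    refine hS.le_of_ge (y := insert W S) ⟨?_, ?_⟩ (Set.subset_insert W S) (Set.mem_insert W S)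
    · rintro V (rfl | hV)
      exacts [⟨hWi, hWW⟩, hS.prop.1 V hV]
    · refine hS.prop.2.insert fun V hV _ => ⟨?_, hWV V hV⟩
      have := congrArg ContinuousLinearMap.adjoint (hWV V hV)
      simpa [ContinuousLinearMap.adjoint_comp] using this
  -- By maximality `W` is itself in `S`, so `W W† = 0` and `W = W W† W = 0`. Then `X` vanishes on
  -- `R`, against `X v ≠ 0`.
  have hW : W = 0 := by
    rw [← hWW, ← ContinuousLinearMap.comp_assoc, hWV W hWmem, ContinuousLinearMap.zero_comp]
  have h1 := DFunLike.congr_fun (hWne hW) v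
  change X (R.starProjection v) = 0 at h1
  rw [Submodule.starProjection_eq_self_iff.2 ((hR v).2 hv)] at h1
  exact hXv h1

/-- For a separating family of partial isometries with orthogonal initial spaces, the projections
onto the initial spaces sum to the identity. -/
theorem hasSum_adjoint_comp_self {S : Set (H →L[ℂ] K)}
    (hS : ∀ V ∈ S, V ∘L V.adjoint ∘L V = V) (hp : S.Pairwise (fun V W => W ∘L V.adjoint = 0))
    (h0 : ∀ v, (∀ V ∈ S, V v = 0) → v = 0) (x : H) :
    HasSum (fun V : S => V.1.adjoint (V.1 x)) x := by
  classical
  have hVV : ∀ (V : S) y, V.1 (V.1.adjoint (V.1 y)) = V.1 y := fun V y =>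
    DFunLike.congr_fun (hS V.1 V.2) y
  have hVW : ∀ V W : S, V ≠ W → ∀ y, W.1 (V.1.adjoint y) = 0 := fun V W h y =>
    DFunLike.congr_fun (hp V.2 W.2 (Subtype.coe_injective.ne h)) y
  have hfam : OrthogonalFamily ℂ (fun V : S => (LinearMap.range V.1.adjoint.toLinearMap))
      (fun V => (LinearMap.range V.1.adjoint.toLinearMap).subtypeₗᵢ) := by
    rintro V W h ⟨_, y, rfl⟩ ⟨_, z, rfl⟩
    change ⟪V.1.adjoint y, W.1.adjoint z⟫_ℂ = 0
    rw [ContinuousLinearMap.adjoint_inner_right, hVW V W h, inner_zero_left]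
  let f : ∀ V : S, LinearMap.range V.1.adjoint.toLinearMap := fun V => ⟨V.1.adjoint (V.1 x), _, rfl⟩
  -- Bessel's inequality: a finite partial sum `p` satisfies `‖p‖² = ⟨x, p⟩ ≤ ‖x‖ ‖p‖`, whence `‖p‖²
  -- ≤ ‖x‖²`.
  have hsum : Summable fun V : S => ‖f V‖ ^ 2 := by
    refine summable_of_sum_le (c := ‖x‖ ^ 2) (fun _ => by positivity) fun F => ?_
    have h1 : ‖∑ V ∈ F, V.1.adjoint (V.1 x)‖ ^ 2 = ∑ V ∈ F, ‖f V‖ ^ 2 := hfam.norm_sum f F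
    have h2 : ⟪x, ∑ V ∈ F, V.1.adjoint (V.1 x)⟫_ℂ = ((∑ V ∈ F, ‖f V‖ ^ 2 : ℝ) : ℂ) := by
      rw [inner_sum, Complex.ofReal_sum]
      refine Finset.sum_congr rfl fun V _ => ?_
      change _ = ((‖V.1.adjoint (V.1 x)‖ ^ 2 : ℝ) : ℂ)
      have h3 := inner_self_eq_norm_sq_to_K (𝕜 := ℂ) (V.1.adjoint (V.1 x))
      rw [ContinuousLinearMap.adjoint_inner_right, hVV] at h3
      rw [ContinuousLinearMap.adjoint_inner_right, h3]
      norm_cast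
    rw [← h1] at h2 ⊢
    have h3 := norm_inner_le_norm (𝕜 := ℂ) x (∑ V ∈ F, V.1.adjoint (V.1 x))
    rw [h2, Complex.norm_real, Real.norm_of_nonneg (by positivity)] at h3
    nlinarith [norm_nonneg x, norm_nonneg (∑ V ∈ F, V.1.adjoint (V.1 x)),
      sq_nonneg (‖x‖ - ‖∑ V ∈ F, V.1.adjoint (V.1 x)‖)]
  obtain ⟨z, hz⟩ := (hfam.summable_iff_norm_sq_summable f).2 hsum
  change HasSum (fun V : S => V.1.adjoint (V.1 x)) z at hz
  -- Only the term `V = W` survives in `W z`, so every `W` in the family kills `x - z`, and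
  -- separation gives `z = x`.
  have : x - z = 0 := h0 _ fun W hW => by
    have h1 := hz.mapL W
    have h2 : HasSum (fun V : S => W (V.1.adjoint (V.1 x))) (W x) := by
      have := hasSum_single (f := fun V : S => W (V.1.adjoint (V.1 x))) ⟨W, hW⟩
        fun V hV => hVW V ⟨W, hW⟩ hV _
      simpa only [hVV ⟨W, hW⟩ x] using this
    rw [map_sub, h2.unique h1, sub_self]
  exact sub_eq_zero.1 this ▸ hz

/-- If the intertwiners from `s` to `t` separate points, then the restriction of every vector state
to the words in `s` is a mixture of vector states on the words in `t`. -/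
theorem exists_vectors_of_separating (hs : ∀ i, (s i).adjoint = s (σ i))
    (ht : ∀ i, (t i).adjoint = t (σ i))
    (hsep : ∀ v : H, v ≠ 0 → ∃ X : H →L[ℂ] K, Intertwines s t X ∧ X v ≠ 0) (η : H) :
    ∃ (S : Set (H →L[ℂ] K)) (ζ : S → K), ∀ w : List ι,
      HasSum (fun k => ⟪ζ k, (w.map t).prod (ζ k)⟫_ℂ) ⟪η, (w.map s).prod η⟫_ℂ := by
  obtain ⟨S, hS, hp, h0⟩ := exists_separating_partialIsometries hs ht hsep
  refine ⟨S, fun V => V.1 η, fun w => ?_⟩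
  -- Expand `w η = ∑ V†V w η` and pair with `η`; moving `V` past the word gives `⟨V η, w V η⟩`, so
  -- the vectors are `V η`.
  have h1 := (hasSum_adjoint_comp_self (fun V hV => (hS V hV).2) hp h0
    ((w.map s).prod η)).mapL (innerSL ℂ η)
  have h2 : ∀ V : S, innerSL ℂ η (V.1.adjoint (V.1 ((w.map s).prod η))) =
      ⟪V.1 η, (w.map t).prod (V.1 η)⟫_ℂ := fun V => by
    rw [innerSL_apply_apply, ContinuousLinearMap.adjoint_inner_right, (hS V V.2).1.list_prod]
  simp only [h2] at h1
  exact h1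

theorem adjoint_list_prod (hs : ∀ i, (s i).adjoint = s (σ i)) (w : List ι) :
    (w.map s).prod.adjoint = (((w.map σ).reverse).map s).prod := by
  induction w with
  | nil => exact star_one _
  | cons i w ih =>
    simp only [List.map_cons, List.prod_cons, List.reverse_cons, List.map_append,
      List.prod_append, List.map_nil, List.prod_nil, mul_one]
    rw [← ih, ← hs]
    exact star_mul _ _

/-- Gram matrices of vectors `w x` are again expectations of words, so the expectations determine
the norms of all linear combinations. -/
theorem inner_list_prod (hs : ∀ i, (s i).adjoint = s (σ i)) (v w : List ι) (x : H) :
    ⟪(v.map s).prod x, (w.map s).prod x⟫_ℂ =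
      ⟪x, (((v.map σ).reverse ++ w).map s).prod x⟫_ℂ := by
  rw [← ContinuousLinearMap.adjoint_inner_right, adjoint_list_prod hs, List.map_append,
    List.prod_append]
  rfl

/-- If a vector state `Ω` on the words in `s` is a mixture of vector states `ζₖ` on the words in
`t`, then there are intertwiners mapping `Ω` to `ζₖ`. -/
theorem exists_intertwiner (hs : ∀ i, (s i).adjoint = s (σ i))
    (ht : ∀ i, (t i).adjoint = t (σ i)) {κ : Type*} {Ω : H} {ζ : κ → K}
    (h : ∀ w : List ι,
      HasSum (fun k => ⟪ζ k, (w.map t).prod (ζ k)⟫_ℂ) ⟪Ω, (w.map s).prod Ω⟫_ℂ) (k : κ) :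
    ∃ X : H →L[ℂ] K, Intertwines s t X ∧ X Ω = ζ k := by
  -- Working on the free vector space over words avoids any question of well-definedness: `‖F k c‖ ≤
  -- ‖E c‖` makes `E c ↦ F k c` a bounded map.
  let E : (List ι →₀ ℂ) →ₗ[ℂ] H := Finsupp.linearCombination ℂ fun w => (w.map s).prod Ω
  let F : κ → (List ι →₀ ℂ) →ₗ[ℂ] K := fun k =>
    Finsupp.linearCombination ℂ fun w => (w.map t).prod (ζ k)
  have hE : ∀ c, ⟪E c, E c⟫_ℂ = ∑ w ∈ c.support, c w * ∑ v ∈ c.support, starRingEnd ℂ (c v) *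
      ⟪Ω, (((v.map σ).reverse ++ w).map s).prod Ω⟫_ℂ := fun c => by
    simp only [E, Finsupp.linearCombination_apply, Finsupp.sum, sum_inner, inner_sum,
      inner_smul_left, inner_smul_right, inner_list_prod hs]
  have hF : ∀ k c, ⟪F k c, F k c⟫_ℂ = ∑ w ∈ c.support, c w * ∑ v ∈ c.support,
      starRingEnd ℂ (c v) * ⟪ζ k, (((v.map σ).reverse ++ w).map t).prod (ζ k)⟫_ℂ := fun k c => by
    simp only [F, Finsupp.linearCombination_apply, Finsupp.sum, sum_inner, inner_sum,
      inner_smul_left, inner_smul_right, inner_list_prod ht]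
  have hsum : ∀ c, HasSum (fun k => ‖F k c‖ ^ 2) (‖E c‖ ^ 2) := fun c => by
    have h1 : HasSum (fun k => ⟪F k c, F k c⟫_ℂ) ⟪E c, E c⟫_ℂ := by
      simp only [hE, hF]
      exact hasSum_sum fun w _ => (hasSum_sum fun v _ => (h _).mul_left _).mul_left _
    have h2 := Complex.hasSum_re h1
    have h3 := fun x : K => inner_self_eq_norm_sq (𝕜 := ℂ) x
    have h4 := inner_self_eq_norm_sq (𝕜 := ℂ) (E c)
    simp only [RCLike.re_to_complex] at h3 h4
    simpa only [h3, h4] using h2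
  have hle : ∀ c, ‖F k c‖ ≤ ‖E c‖ := fun c =>
    (pow_le_pow_iff_left₀ (norm_nonneg _) (norm_nonneg _) two_ne_zero).1
      (le_hasSum (hsum c) k fun _ _ => by positivity)
  obtain ⟨X, hX, hX0⟩ := exists_extension_of_norm_le E (F k) hle
  have hEs : ∀ i c, s i (E c) = E (c.mapDomain (List.cons i)) := fun i c => by
    simp only [E, Finsupp.linearCombination_mapDomain]
    rw [Finsupp.linearCombination_apply, Finsupp.linearCombination_apply, Finsupp.sum, Finsupp.sum,
      map_sum]
    simp only [map_smul]
    rfl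
  have hFt : ∀ i c, t i (F k c) = F k (c.mapDomain (List.cons i)) := fun i c => by
    simp only [F, Finsupp.linearCombination_mapDomain]
    rw [Finsupp.linearCombination_apply, Finsupp.linearCombination_apply, Finsupp.sum, Finsupp.sum,
      map_sum]
    simp only [map_smul]
    rfl
  refine ⟨X, fun i x => ?_, ?_⟩
  · refine DFunLike.congr_fun (ContinuousLinearMap.ext_of_range_of_orthogonal E
      (F := X ∘L s i) (G := t i ∘L X) (fun c => ?_) fun v hv => ?_) x
    · change X (s i (E c)) = t i (X (E c))
      rw [hEs, hX, hX, hFt]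
    · change X (s i v) = t i (X v)
      rw [hX0 v hv, map_zero]
      refine hX0 _ fun c => ?_
      rw [← ContinuousLinearMap.adjoint_inner_left, hs, hEs]
      exact hv _
  -- The empty word denotes the identity, so it recovers `Ω` and `ζₖ`.
  · have h1 := hX (Finsupp.single [] 1)
    simp only [E, F, Finsupp.linearCombination_single, one_smul] at h1
    exact h1

end Intertwiners

/-! ### Graph-preserving operators, resolvents and the polar decomposition. -/

section GraphResolvent

variable {H : Type*} [NormedAddCommGroup H] [InnerProductSpace ℂ H] [CompleteSpace H]

/-- The hypothesis `h` says that `(z - x, -y)` is orthogonal to the graph, which characterises the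
projection of `(z, 0)`. -/
theorem resolventSq_unique {T : H →ₗ.[ℂ] H} (hT : T.IsClosed) {x y z : H}
    (hxy : (x, y) ∈ T.graph)
    (h : ∀ g k, (g, k) ∈ T.graph → ⟪g, z⟫_ℂ = ⟪g, x⟫_ℂ + ⟪k, y⟫_ℂ) :
    x = resolventSq T z ∧ y = opResolventSq T z := by
  have hsub : (x - resolventSq T z, y - opResolventSq T z) ∈ T.graph :=
    T.graph.sub_mem hxy (graphProj_mem hT z)
  have h1 := h _ _ hsub
  rw [inner_graphProj hT z hsub] at h1
  have h2 : ⟪x - resolventSq T z, x - resolventSq T z⟫_ℂ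
      + ⟪y - opResolventSq T z, y - opResolventSq T z⟫_ℂ = 0 := by
    rw [inner_sub_right _ x, inner_sub_right _ y]
    linear_combination -h1
  rw [inner_self_eq_norm_sq_to_K, inner_self_eq_norm_sq_to_K] at h2
  have h3 : ‖x - resolventSq T z‖ ^ 2 + ‖y - opResolventSq T z‖ ^ 2 = 0 := by
    apply Complex.ofReal_eq_zero.1
    push_cast
    exact h2
  have h4 : ‖x - resolventSq T z‖ = 0 := by nlinarith [sq_nonneg ‖y - opResolventSq T z‖]
  have h5 : ‖y - opResolventSq T z‖ = 0 := by nlinarith [sq_nonneg ‖x - resolventSq T z‖]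
  exact ⟨sub_eq_zero.1 (norm_eq_zero.1 h4), sub_eq_zero.1 (norm_eq_zero.1 h5)⟩

/-- The vectors `(R z, T R z)`, with `R = (1 + T†T)⁻¹`, are dense in the graph of `T`. -/
theorem graph_subset_closure {T : H →ₗ.[ℂ] H} (hT : T.IsClosed) {x y : H}
    (hxy : (x, y) ∈ T.graph) :
    (x, y) ∈ closure (Set.range fun z => (resolventSq T z, opResolventSq T z)) := by
  let C := (LinearMap.range (graphProj T).toLinearMap).topologicalClosure
  have : CompleteSpace C := (Submodule.isClosed_topologicalClosure _).completeSpace_coe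
  have hC : C ≤ hilbertGraph T := by
    refine Submodule.topologicalClosure_minimal _ ?_ (Submodule.isClosed_topologicalClosure _)
    rintro _ ⟨z, rfl⟩
    exact Submodule.starProjection_apply_mem _ _
  let p : WithLp 2 (H × H) := WithLp.toLp 2 (x, y)
  have hp : p ∈ hilbertGraph T := (mem_hilbertGraph hT _).2 hxy
  obtain ⟨c, hc, q, hq, hpq⟩ := C.exists_add_mem_mem_orthogonal p
  have hqG : (q.fst, q.snd) ∈ T.graph := by
    rw [← mem_hilbertGraph hT]
    have : q = p - c := by rw [hpq]; abel
    exact this ▸ sub_mem hp (hC hc)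
  -- The component `q` lies in the graph and is orthogonal to every projection of `(z, 0)`, hence to
  -- every `(z, 0)`. A graph contains no nonzero `(0, y)`, so `q = 0`.
  have hq1 : q.fst = 0 := by
    refine ext_inner_right ℂ fun z => ?_
    have h1 := hq _ (Submodule.le_topologicalClosure _ ⟨z, rfl⟩)
    rw [← inner_conj_symm, map_eq_zero, WithLp.prod_inner_apply] at h1
    rw [inner_graphProj hT z hqG, inner_zero_left]
    exact h1
  have hq2 : q.snd = 0 := T.graph_fst_eq_zero_snd hqG hq1
  have hq0 : q = 0 := by
    rw [← norm_eq_zero, ← sq_eq_zero_iff, WithLp.prod_norm_sq_eq_of_L2, hq1, hq2]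
    simp
  have hpC : p ∈ C := by rw [hpq, hq0, add_zero]; exact hc
  have h2 := image_closure_subset_closure_image
    (WithLp.prodContinuousLinearEquiv 2 ℂ H H).continuous ⟨p, hpC, rfl⟩
  refine closure_mono ?_ h2
  rintro _ ⟨_, ⟨z, rfl⟩, rfl⟩
  exact ⟨z, rfl⟩

/-- If `B` and `B†` leave the graph of `T` invariant, then `B` commutes with `(1 + T†T)⁻¹` and
with `T (1 + T†T)⁻¹`. -/
theorem resolventSq_comm {T : H →ₗ.[ℂ] H} (hT : T.IsClosed) {B : H →L[ℂ] H}
    (h1 : ∀ x y, (x, y) ∈ T.graph → (B x, B y) ∈ T.graph)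
    (h2 : ∀ x y, (x, y) ∈ T.graph → (B.adjoint x, B.adjoint y) ∈ T.graph) (z : H) :
    B (resolventSq T z) = resolventSq T (B z) ∧ B (opResolventSq T z) = opResolventSq T (B z) := by
  refine resolventSq_unique hT (h1 _ _ (graphProj_mem hT z)) fun g k hgk => ?_
  rw [← ContinuousLinearMap.adjoint_inner_left, inner_graphProj hT z (h2 _ _ hgk),
    ContinuousLinearMap.adjoint_inner_left, ContinuousLinearMap.adjoint_inner_left]

/-- If `B` commutes with `(1 + T†T)⁻¹` and `T (1 + T†T)⁻¹`, then it leaves the graph of `T`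
invariant. -/
theorem graph_invariant_of_comm {T : H →ₗ.[ℂ] H} (hT : T.IsClosed) {B : H →L[ℂ] H}
    (h1 : ∀ z, B (resolventSq T z) = resolventSq T (B z))
    (h2 : ∀ z, B (opResolventSq T z) = opResolventSq T (B z)) {x y : H}
    (hxy : (x, y) ∈ T.graph) : (B x, B y) ∈ T.graph := by
  have hcl : IsClosed {p : H × H | (B p.1, B p.2) ∈ T.graph} :=
    hT.preimage (f := fun p : H × H => (B p.1, B p.2)) (by fun_prop)
  refine closure_minimal (t := {p : H × H | (B p.1, B p.2) ∈ T.graph}) ?_ hcl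
    (graph_subset_closure hT hxy)
  rintro _ ⟨z, rfl⟩
  change (B (resolventSq T z), B (opResolventSq T z)) ∈ T.graph
  rw [h1, h2]
  exact graphProj_mem hT _

section SelfAdjoint

variable {S : H →ₗ.[ℂ] H}

/-- For self-adjoint `S` and `R = (1 + S²)⁻¹`, one has `S (S R z) = z - R z`. -/
theorem opResolventSq_mem_graph (hS : IsSelfAdjoint S) (z : H) :
    (opResolventSq S z, z - resolventSq S z) ∈ S.graph := by
  have hd := hS.dense_domain
  have h1 : S.graph = S.graph.adjoint := by
    rw [← LinearPMap.adjoint_graph_eq_graph_adjoint hd, LinearPMap.isSelfAdjoint_def.1 hS]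
  rw [h1, Submodule.mem_adjoint_iff]
  intro a b hab
  have h2 := inner_graphProj hS.isClosed z hab
  rw [inner_sub_right]
  linear_combination -h2

theorem inner_graph_symm (hS : IsSelfAdjoint S) {a b c d : H} (hab : (a, b) ∈ S.graph)
    (hcd : (c, d) ∈ S.graph) : ⟪b, c⟫_ℂ = ⟪a, d⟫_ℂ := by
  have h1 : S.graph = S.graph.adjoint := by
    rw [← LinearPMap.adjoint_graph_eq_graph_adjoint hS.dense_domain,
      LinearPMap.isSelfAdjoint_def.1 hS]
  rw [h1, Submodule.mem_adjoint_iff] at hcd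
  exact sub_eq_zero.1 (hcd a b hab)

/-- Splitting a vector as `R z + (z - R z)` reduces the claim to the symmetry of `S` on pairs of its
graph; the same splitting proves positivity. -/
theorem opResolventSq_symm (hS : IsSelfAdjoint S) (z w : H) :
    ⟪opResolventSq S z, w⟫_ℂ = ⟪z, opResolventSq S w⟫_ℂ := by
  have e1 : ∀ z : H, z = resolventSq S z + (z - resolventSq S z) := fun z => by abel
  have hz := graphProj_mem hS.isClosed z
  have hw := graphProj_mem hS.isClosed w
  have hz' := opResolventSq_mem_graph hS z
  have hw' := opResolventSq_mem_graph hS w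
  have e2 := inner_graph_symm hS hz hw
  have e3 := inner_graph_symm hS hz' hw'
  conv_lhs => rw [e1 w, inner_add_right]
  conv_rhs => rw [e1 z, inner_add_left]
  rw [e2, e3]

theorem opResolventSq_nonneg (hS : IsSelfAdjoint S)
    (h0 : ∀ x : S.domain, 0 ≤ (⟪(x : H), S x⟫_ℂ).re) : 0 ≤ opResolventSq S := by
  have h1 : ∀ x y, (x, y) ∈ S.graph → 0 ≤ (⟪x, y⟫_ℂ).re := fun x y hxy => by
    obtain ⟨v, rfl, rfl⟩ := S.mem_graph_iff.1 hxy
    exact h0 v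
  rw [ContinuousLinearMap.nonneg_iff_isPositive, ContinuousLinearMap.isPositive_def]
  refine ⟨fun x y => opResolventSq_symm hS x y, fun x => ?_⟩
  rw [ContinuousLinearMap.reApplyInnerSelf_apply, ← inner_re_symm]
  have e1 : ⟪x, opResolventSq S x⟫_ℂ = ⟪resolventSq S x, opResolventSq S x⟫_ℂ +
      ⟪x - resolventSq S x, opResolventSq S x⟫_ℂ := by
    rw [← inner_add_left, add_sub_cancel]
  rw [e1, map_add]
  have h2 := h1 _ _ (graphProj_mem hS.isClosed x)
  have h3 := h1 _ _ (opResolventSq_mem_graph hS x)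
  refine add_nonneg ?_ ?_
  · exact h2
  · have h4 := inner_re_symm (𝕜 := ℂ) (opResolventSq S x) (x - resolventSq S x)
    exact h4 ▸ h3

/-- Together with positivity this identifies `S R` as the square root of `R - R²`, so whatever
commutes with `R` commutes with `S R`. -/
theorem opResolventSq_mul_self (hS : IsSelfAdjoint S) :
    opResolventSq S * opResolventSq S = resolventSq S - resolventSq S * resolventSq S := by
  ext z
  refine ext_inner_left ℂ fun w => ?_
  change ⟪w, opResolventSq S (opResolventSq S z)⟫_ℂ =
    ⟪w, resolventSq S z - resolventSq S (resolventSq S z)⟫_ℂ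
  have hR := fun x y => ((ContinuousLinearMap.nonneg_iff_isPositive _).1
    (resolventSq_nonneg hS.isClosed)).inner_left_eq_inner_right x y
  rw [← opResolventSq_symm hS, inner_sub_right, ← hR, ← hR]
  have := inner_resolventSq hS.isClosed w z
  linear_combination -this

end SelfAdjoint

section PolarDecomposition

variable {T S : H →ₗ.[ℂ] H} {u : H →L[ℂ] H}

theorem IsPolarDecomposition.inner_map (hp : IsPolarDecomposition T u S) {a b c d : H}
    (hab : (a, b) ∈ S.graph) (hcd : (c, d) ∈ S.graph) : ⟪u b, u d⟫_ℂ = ⟪b, d⟫_ℂ := by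
  let F : LinearMap.range S.toFun →ₗᵢ[ℂ] H :=
    { toLinearMap := u.toLinearMap ∘ₗ (LinearMap.range S.toFun).subtype
      norm_map' := by
        rintro ⟨_, x, rfl⟩
        exact hp.isometry x }
  obtain ⟨x, rfl, rfl⟩ := S.mem_graph_iff.1 hab
  obtain ⟨y, rfl, rfl⟩ := S.mem_graph_iff.1 hcd
  exact F.inner_map_map ⟨S x, x, rfl⟩ ⟨S y, y, rfl⟩

/-- The map `(x, w) ↦ (x, u w)` carries the graph of `S` isometrically onto that of `T` and keeps
first components, so the projections of `(z, 0)` correspond. -/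
theorem IsPolarDecomposition.resolventSq_eq (hp : IsPolarDecomposition T u S) (hT : T.IsClosed)
    (z : H) : resolventSq S z = resolventSq T z ∧ u (opResolventSq S z) = opResolventSq T z := by
  have hS := hp.selfAdjoint.isClosed
  refine resolventSq_unique hT ((hp.graph_iff _ _).2 ⟨_, graphProj_mem hS z, rfl⟩) fun g k hgk => ?_
  obtain ⟨w, hw, rfl⟩ := (hp.graph_iff _ _).1 hgk
  rw [hp.inner_map hw (graphProj_mem hS z), inner_graphProj hS z hw]

/-- The pairs `(R z, S R z)` are dense in the graph of `S`, so orthogonality to the range of `S` can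
be tested on the bounded operator `S R`. -/
theorem IsPolarDecomposition.phase_eq_zero (hp : IsPolarDecomposition T u S) {v : H}
    (hv : ∀ z, ⟪opResolventSq S z, v⟫_ℂ = 0) : u v = 0 := by
  refine hp.apply_eq_zero v fun x => ?_
  have h1 := graph_subset_closure hp.selfAdjoint.isClosed (S.mem_graph x)
  have hcl : IsClosed {p : H × H | ⟪p.2, v⟫_ℂ = 0} := isClosed_eq (by fun_prop) (by fun_prop)
  refine closure_minimal (t := {p : H × H | ⟪p.2, v⟫_ℂ = 0}) ?_ hcl h1
  rintro _ ⟨z, rfl⟩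
  exact hv z

/-- If `B` and `B†` leave the graph of `T` invariant, then `B` commutes with `(1 + |T|²)⁻¹` and
with the phase of `T`. -/
theorem IsPolarDecomposition.commute_of_graph_invariant (hp : IsPolarDecomposition T u S)
    (hT : T.IsClosed) {B : H →L[ℂ] H}
    (h1 : ∀ x y, (x, y) ∈ T.graph → (B x, B y) ∈ T.graph)
    (h2 : ∀ x y, (x, y) ∈ T.graph → (B.adjoint x, B.adjoint y) ∈ T.graph) :
    Commute (resolventSq S) B ∧ Commute u B := by
  have hS := hp.selfAdjoint
  have hN0 := opResolventSq_nonneg hS hp.nonneg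
  have hN : opResolventSq S = CFC.sqrt (resolventSq S - resolventSq S * resolventSq S) :=
    (CFC.sqrt_unique (opResolventSq_mul_self hS) hN0).symm
  have key : ∀ B : H →L[ℂ] H, (∀ x y, (x, y) ∈ T.graph → (B x, B y) ∈ T.graph) →
      (∀ x y, (x, y) ∈ T.graph → (B.adjoint x, B.adjoint y) ∈ T.graph) →
      Commute (resolventSq S) B ∧ Commute (opResolventSq S) B := fun B h1 h2 => by
    have hR : Commute (resolventSq S) B := by
      ext z
      change resolventSq S (B z) = B (resolventSq S z)
      rw [(hp.resolventSq_eq hT _).1, (hp.resolventSq_eq hT _).1, (resolventSq_comm hT h1 h2 z).1]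
    refine ⟨hR, ?_⟩
    rw [hN]
    exact Commute.cfcₙ_nnreal (hR.sub_left (hR.mul_left hR)) _
  have hNB := fun z => DFunLike.congr_fun (key B h1 h2).2.eq z
  have hNB' := fun z => DFunLike.congr_fun
    (key B.adjoint h2 (by simpa only [ContinuousLinearMap.adjoint_adjoint] using h1)).2.eq z
  refine ⟨(key B h1 h2).1, ?_⟩
  -- On the range of `S R` the phase is determined by `u S R = T R`; on the orthogonal complement,
  -- preserved by `B` since `B†` commutes with `S R`, it vanishes.
  refine ContinuousLinearMap.ext_of_range_of_orthogonal (opResolventSq S).toLinearMap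
    (fun z => ?_)
    fun v hv => ?_
  · change u (B (opResolventSq S z)) = B (u (opResolventSq S z))
    have h3 : opResolventSq S (B z) = B (opResolventSq S z) := hNB z
    rw [← h3, (hp.resolventSq_eq hT _).2, (hp.resolventSq_eq hT _).2,
      (resolventSq_comm hT h1 h2 z).2]
  · change u (B v) = B (u v)
    rw [hp.phase_eq_zero hv, map_zero]
    refine hp.phase_eq_zero fun z => ?_
    have h3 : opResolventSq S (B.adjoint z) = B.adjoint (opResolventSq S z) := hNB' z
    rw [← ContinuousLinearMap.adjoint_inner_left, ← h3]
    exact hv _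

/-- If `B` commutes with the phase of `T`, with `S R` and with `S² R³`, where `S = |T|` and
`R = (1 + S²)⁻¹`, then it leaves the graph of `T` invariant. -/
theorem IsPolarDecomposition.graph_invariant (hp : IsPolarDecomposition T u S)
    (hT : T.IsClosed) (hd : Dense (T.domain : Set H)) {B : H →L[ℂ] H} (hu : Commute u B)
    (hN : Commute (opResolventSq S) B)
    (hRN : Commute (resolventSq S * (opResolventSq S * opResolventSq S)) B) {x y : H}
    (hxy : (x, y) ∈ T.graph) : (B x, B y) ∈ T.graph := by
  have hS := hp.selfAdjoint
  have hNs := opResolventSq_symm hS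
  have hNx : ∀ z, opResolventSq S (B z) = B (opResolventSq S z) := DFunLike.congr_fun hN.eq
  have hux : ∀ z, u (B z) = B (u z) := DFunLike.congr_fun hu.eq
  have hRNx : ∀ z, resolventSq S (opResolventSq S (opResolventSq S (B z))) =
    B (resolventSq S (opResolventSq S (opResolventSq S z))) := DFunLike.congr_fun hRN.eq
  have hNN : ∀ z, opResolventSq S (opResolventSq S z) =
    resolventSq S z - resolventSq S (resolventSq S z) :=
    DFunLike.congr_fun (opResolventSq_mul_self hS)
  have hker : ∀ v, opResolventSq S v = 0 → resolventSq S v = v := fun v hv => by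
    have h1 := hNN v
    rw [hv, map_zero, ← map_sub, (hp.resolventSq_eq hT _).1] at h1
    exact (sub_eq_zero.1 (resolventSq_injective hT hd h1.symm)).symm
  -- With `N = S R`, commutation with `R` is recovered from `N` and `R N²`: on the range of `N²` it
  -- follows from the two hypotheses, and on its complement `ker N`, which `B` preserves, `R` is the
  -- identity.
  have hR : ∀ z, resolventSq S (B z) = B (resolventSq S z) := fun z => by
    refine DFunLike.congr_fun (ContinuousLinearMap.ext_of_range_of_orthogonal
      (opResolventSq S ∘L opResolventSq S).toLinearMap (F := resolventSq S ∘L B) (G := B ∘L resolventSq S)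
      (fun z => ?_) fun v hv => ?_) z
    · change resolventSq S (B (opResolventSq S (opResolventSq S z))) = B (resolventSq S _)
      rw [← hNx, ← hNx, hRNx]
      rfl
    · have h0 : opResolventSq S v = 0 := by
        rw [← inner_self_eq_zero (𝕜 := ℂ), ← hNs]
        exact hv v
      change resolventSq S (B v) = B (resolventSq S v)
      rw [hker v h0, hker (B v) (by rw [hNx, h0, map_zero])]
  refine graph_invariant_of_comm hT (fun z => ?_) (fun z => ?_) hxy
  · rw [← (hp.resolventSq_eq hT _).1, ← (hp.resolventSq_eq hT _).1, hR]
  · rw [← (hp.resolventSq_eq hT _).2, ← (hp.resolventSq_eq hT _).2, hNx, hux]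

end PolarDecomposition

end GraphResolvent

/-! ### Bounded Borel functions of a positive self-adjoint operator. -/

section BoundedFunction

open MeasureTheory
open scoped CompactlySupported

variable {H : Type*} [NormedAddCommGroup H] [InnerProductSpace ℂ H] [CompleteSpace H]

theorem ContinuousLinearMap.ext_of_inner_self {D E : H →L[ℂ] H}
    (h : ∀ x, ⟪x, D x⟫_ℂ = ⟪x, E x⟫_ℂ) : D = E := by
  apply ContinuousLinearMap.coe_inj.1
  refine (ext_inner_map _ _).1 fun x => ?_
  change ⟪D x, x⟫_ℂ = ⟪E x, x⟫_ℂ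
  rw [← inner_conj_symm, h, inner_conj_symm]

theorem inner_boundedFunction (S : H →ₗ.[ℂ] H) (f : BoundedBorel) (x : H) :
    ⟪x, boundedFunction S f x⟫_ℂ = ∫ r, f.1 (√(r⁻¹ - 1)) ∂(vectorMeasure (resolventSq S) x) :=
  (hasBorelCalculus (resolventSq S) (measurable_comp_sqrt_inv f)
    (fun _ => f.2.2.choose_spec _)).choose_spec x

/-- The complex conjugate of a bounded Borel function. -/
noncomputable def BoundedBorel.conj (f : BoundedBorel) : BoundedBorel :=
  ⟨fun t => starRingEnd ℂ (f.1 t), RCLike.continuous_conj.measurable.comp f.2.1, by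
    obtain ⟨K, hK⟩ := f.2.2
    exact ⟨K, fun t => by rw [RCLike.norm_conj]; exact hK t⟩⟩

theorem adjoint_boundedFunction (S : H →ₗ.[ℂ] H) (f : BoundedBorel) :
    (boundedFunction S f).adjoint = boundedFunction S f.conj := by
  refine ContinuousLinearMap.ext_of_inner_self fun x => ?_
  rw [ContinuousLinearMap.adjoint_inner_right, ← inner_conj_symm, inner_boundedFunction,
    inner_boundedFunction, ← integral_conj]
  rfl

/-- The definition of `f(S)` gives only its quadratic form. A unitary commuting with `R` leaves the
spectral measures unchanged, hence also this form. -/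
theorem vectorMeasure_unitary {R U : H →L[ℂ] H} (hU : U ∈ unitary (H →L[ℂ] H))
    (hUR : Commute R U) (x : H) : vectorMeasure R (U x) = vectorMeasure R x := by
  unfold vectorMeasure
  congr 1
  ext φ
  change (⟪U x, cfc (φ : ℝ → ℝ) R (U x)⟫_ℂ).re = (⟪x, cfc (φ : ℝ → ℝ) R x⟫_ℂ).re
  have h1 : cfc (φ : ℝ → ℝ) R (U x) = U (cfc (φ : ℝ → ℝ) R x) :=
    DFunLike.congr_fun (hUR.cfc_real φ).eq x
  have h2 : ∀ y, U.adjoint (U y) = y := DFunLike.congr_fun (Unitary.mem_iff.1 hU).1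
  rw [h1, ← ContinuousLinearMap.adjoint_inner_right, h2]

theorem boundedFunction_commute_unitary (S : H →ₗ.[ℂ] H) (f : BoundedBorel) {U : H →L[ℂ] H}
    (hU : U ∈ unitary (H →L[ℂ] H)) (hUR : Commute (resolventSq S) U) :
    Commute (boundedFunction S f) U := by
  have h2 := (Unitary.mem_iff.1 hU).2
  have h3 : U.adjoint ∘L boundedFunction S f ∘L U = boundedFunction S f := by
    refine ContinuousLinearMap.ext_of_inner_self fun x => ?_
    change ⟪x, U.adjoint (boundedFunction S f (U x))⟫_ℂ = _
    rw [ContinuousLinearMap.adjoint_inner_right, inner_boundedFunction, inner_boundedFunction,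
      vectorMeasure_unitary hU hUR]
  change boundedFunction S f * U = U * boundedFunction S f
  conv_rhs => rw [← h3]
  change _ = U * (star U * (boundedFunction S f * U))
  rw [← mul_assoc, h2, one_mul]

/-- A bounded function of `S` commutes with all bounded operators commuting with `(1 + S²)⁻¹`. -/
theorem boundedFunction_commute (S : H →ₗ.[ℂ] H) (f : BoundedBorel) {B : H →L[ℂ] H}
    (h1 : Commute (resolventSq S) B) (hR : IsSelfAdjoint (resolventSq S)) :
    Commute (boundedFunction S f) B := by
  -- The commutant of the self-adjoint `R` is a C*-algebra, so `B` is a combination of four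
  -- unitaries that also commute with `R`.
  let M : StarSubalgebra ℂ (H →L[ℂ] H) := StarSubalgebra.centralizer ℂ {resolventSq S}
  have hM : ∀ B, B ∈ M ↔ Commute (resolventSq S) B := fun B => by
    simp [M, StarSubalgebra.mem_centralizer_iff, hR.star_eq, commute_iff_eq]
  have hcl : IsClosed (M : Set (H →L[ℂ] H)) := by
    have : (M : Set (H →L[ℂ] H)) = {B | resolventSq S * B = B * resolventSq S} :=
      Set.ext fun B => hM B
    rw [this]
    exact isClosed_eq (by fun_prop) (by fun_prop)
  let _ := StarSubalgebra.cstarAlgebra M (h_closed := hcl)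
  obtain ⟨v, c, hv, -⟩ := CStarAlgebra.exists_sum_four_unitary (⟨B, (hM B).2 h1⟩ : M)
  have hB : B = ∑ i, c i • ((v i : M) : H →L[ℂ] H) := by
    have := congrArg M.subtype hv
    simpa using this
  rw [hB]
  refine Commute.sum_right _ _ _ fun i _ => Commute.smul_right ?_ _
  refine boundedFunction_commute_unitary S f ?_ ((hM _).1 (v i : M).2)
  rw [Unitary.mem_iff]
  have := Unitary.mem_iff.1 (v i).2
  exact ⟨congrArg M.subtype this.1, congrArg M.subtype this.2⟩

/-- The spectral measure is tested on `C_c(ℝ)`, which restricts `f` to functions vanishing at zero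
and at infinity. For `1 / (1 + t²)` the composite is `1` off `(0, 1]` and jumps at `0`; hence the
choice of `linDiv` and `sqDivCube`. -/
theorem boundedFunction_eq_cfc (S : H →ₗ.[ℂ] H) (f : BoundedBorel) (φ : C_c(ℝ, ℝ))
    (h : ∀ r : ℝ, f.1 (√(r⁻¹ - 1)) = φ r) :
    boundedFunction S f = cfc (φ : ℝ → ℝ) (resolventSq S) := by
  refine ContinuousLinearMap.ext_of_inner_self fun x => ?_
  rw [inner_boundedFunction, ← integral_vectorMeasure, ← integral_complex_ofReal]
  simp only [h]

/-- The function `t ↦ t / (1 + t²)`. -/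
noncomputable def BoundedBorel.linDiv : BoundedBorel :=
  ⟨fun t => ((t / (1 + t ^ 2) : ℝ) : ℂ), by fun_prop, 1, fun t => by
    rw [Complex.norm_real, Real.norm_eq_abs, abs_le, le_div_iff₀ (by positivity),
      div_le_iff₀ (by positivity)]
    constructor <;> nlinarith [sq_nonneg (t - 1), sq_nonneg (t + 1)]⟩

/-- The function `t ↦ t² / (1 + t²)³`. -/
noncomputable def BoundedBorel.sqDivCube : BoundedBorel :=
  ⟨fun t => ((t ^ 2 / (1 + t ^ 2) ^ 3 : ℝ) : ℂ), by fun_prop, 1, fun t => by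
    rw [Complex.norm_real, Real.norm_of_nonneg (by positivity), div_le_one (by positivity)]
    nlinarith [sq_nonneg t, sq_nonneg (t ^ 2), sq_nonneg (t ^ 3)]⟩

/-- The compactly supported function on the line equal to `√(r - r²)` on `[0, 1]`. -/
noncomputable def sqrtBump : C_c(ℝ, ℝ) :=
  ⟨⟨fun r => √(r - r ^ 2), by fun_prop⟩, by
    refine HasCompactSupport.intro (K := Set.Icc 0 1) isCompact_Icc fun r hr => ?_
    refine Real.sqrt_eq_zero_of_nonpos ?_
    by_contra h
    exact hr ⟨by nlinarith, by nlinarith⟩⟩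

theorem sqrtBump_apply (r : ℝ) : sqrtBump r = √(r - r ^ 2) := rfl

/-- Substituting `r = 1 / (1 + t²)` turns `t / (1 + t²)` into `√(r - r²)`. Off `(0, 1]` both sides
vanish, by the conventions `0⁻¹ = 0` and `√x = 0` for `x ≤ 0`. -/
theorem linDiv_comp (r : ℝ) : BoundedBorel.linDiv.1 (√(r⁻¹ - 1)) = (sqrtBump r : ℂ) := by
  rw [sqrtBump_apply]
  change ((√(r⁻¹ - 1) / (1 + √(r⁻¹ - 1) ^ 2) : ℝ) : ℂ) = _
  congr 1
  by_cases h : 0 < r ∧ r ≤ 1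
  · obtain ⟨h0, h1⟩ := h
    have h2 : 0 ≤ r⁻¹ - 1 := sub_nonneg.2 ((one_le_inv₀ h0).2 h1)
    rw [Real.sq_sqrt h2, add_sub_cancel, div_inv_eq_mul]
    have h3 : r - r ^ 2 = (r⁻¹ - 1) * r ^ 2 := by field_simp
    rw [h3, Real.sqrt_mul h2, Real.sqrt_sq h0.le]
  · have h2 : r⁻¹ - 1 ≤ 0 := by
      rcases le_or_gt r 0 with h0 | h0
      · linarith [inv_nonpos.2 h0]
      · exact sub_nonpos.2 (inv_le_one_of_one_le₀ (not_le.1 fun h1 => h ⟨h0, h1⟩).le)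
    have h3 : r - r ^ 2 ≤ 0 := by
      by_contra h4
      exact h ⟨by nlinarith, by nlinarith⟩
    rw [Real.sqrt_eq_zero_of_nonpos h2, Real.sqrt_eq_zero_of_nonpos h3, zero_div]

/-- The compactly supported function on the line equal to `r (r - r²)` on `[0, 1]`. -/
noncomputable def cubicBump : C_c(ℝ, ℝ) :=
  ⟨⟨fun r => r * (√(r - r ^ 2) * √(r - r ^ 2)), by fun_prop⟩, by
    refine HasCompactSupport.intro (K := Set.Icc 0 1) isCompact_Icc fun r hr => ?_
    change r * (√(r - r ^ 2) * √(r - r ^ 2)) = 0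
    rw [Real.sqrt_eq_zero_of_nonpos, mul_zero, mul_zero]
    by_contra h
    exact hr ⟨by nlinarith, by nlinarith⟩⟩

theorem sqDivCube_comp (r : ℝ) : BoundedBorel.sqDivCube.1 (√(r⁻¹ - 1)) = (cubicBump r : ℂ) := by
  have h1 := linDiv_comp r
  rw [sqrtBump_apply] at h1
  have h2 : √(r⁻¹ - 1) / (1 + √(r⁻¹ - 1) ^ 2) = √(r - r ^ 2) := Complex.ofReal_injective h1
  change ((√(r⁻¹ - 1) ^ 2 / (1 + √(r⁻¹ - 1) ^ 2) ^ 3 : ℝ) : ℂ) =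
    ((r * (√(r - r ^ 2) * √(r - r ^ 2)) : ℝ) : ℂ)
  congr 1
  rw [← h2]
  by_cases h : 0 < r ∧ r ≤ 1
  · obtain ⟨h0, h1⟩ := h
    have h3 : 0 ≤ r⁻¹ - 1 := sub_nonneg.2 ((one_le_inv₀ h0).2 h1)
    rw [Real.sq_sqrt h3, add_sub_cancel, div_mul_div_comm, Real.mul_self_sqrt h3]
    field_simp
  · have h2 : r⁻¹ - 1 ≤ 0 := by
      rcases le_or_gt r 0 with h0 | h0
      · linarith [inv_nonpos.2 h0]
      · exact sub_nonpos.2 (inv_le_one_of_one_le₀ (not_le.1 fun h1 => h ⟨h0, h1⟩).le)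
    rw [Real.sqrt_eq_zero_of_nonpos h2]
    simp

/-- Both sides are nonnegative square roots of `R - R²`; the spectrum of `R` lies in `[0, 1]`, where
`r - r²` is nonnegative. -/
theorem boundedFunction_linDiv {S : H →ₗ.[ℂ] H} (hS : IsSelfAdjoint S)
    (h0 : ∀ x : S.domain, 0 ≤ (⟪(x : H), S x⟫_ℂ).re) :
    boundedFunction S BoundedBorel.linDiv = opResolventSq S := by
  rw [boundedFunction_eq_cfc S _ _ linDiv_comp]
  have hR0 := resolventSq_nonneg hS.isClosed
  have hR : IsSelfAdjoint (resolventSq S) := .of_nonneg hR0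
  have hspec : ∀ r ∈ spectrum ℝ (resolventSq S), 0 ≤ r - r ^ 2 := fun r hr => by
    have h1 := spectrum_nonneg_of_nonneg hR0 hr
    have h2 : r ≤ 1 := (CFC.le_one_iff (resolventSq S)).1 (resolventSq_le_one hS.isClosed) r hr
    nlinarith
  rw [← CFC.sqrt_unique (opResolventSq_mul_self hS) (opResolventSq_nonneg hS h0)]
  refine (CFC.sqrt_unique ?_ (cfc_nonneg fun r _ => Real.sqrt_nonneg _)).symm
  have h1 : (resolventSq S - resolventSq S * resolventSq S) =
      cfc (fun r : ℝ => r - r ^ 2) (resolventSq S) := by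
    rw [cfc_sub (fun r : ℝ => r) (fun r => r ^ 2) (resolventSq S), cfc_id' ℝ (resolventSq S),
      cfc_pow_id (resolventSq S) 2, sq]
  rw [h1, ← cfc_mul _ _ _ (by fun_prop) (by fun_prop)]
  exact cfc_congr fun r hr => Real.mul_self_sqrt (hspec r hr)

theorem boundedFunction_sqDivCube {S : H →ₗ.[ℂ] H} (hS : IsSelfAdjoint S)
    (h0 : ∀ x : S.domain, 0 ≤ (⟪(x : H), S x⟫_ℂ).re) :
    boundedFunction S BoundedBorel.sqDivCube =
      resolventSq S * (opResolventSq S * opResolventSq S) := by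
  have hR : IsSelfAdjoint (resolventSq S) := .of_nonneg (resolventSq_nonneg hS.isClosed)
  rw [boundedFunction_eq_cfc S _ _ sqDivCube_comp, ← boundedFunction_linDiv hS h0,
    boundedFunction_eq_cfc S _ _ linDiv_comp]
  conv_rhs => rw [← cfc_mul _ _ _ (by fun_prop) (by fun_prop)]
  conv_rhs => enter [1]; rw [← cfc_id' ℝ (resolventSq S)]
  rw [← cfc_mul _ _ _ (by fun_prop) (by fun_prop)]
  rfl

end BoundedFunction

/-! ### Commutants used as test von Neumann algebras. -/

section VonNeumann

variable {H : Type*} [NormedAddCommGroup H] [InnerProductSpace ℂ H] [CompleteSpace H]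

theorem mem_interVonNeumann {s : Set (VonNeumannAlgebra H)} {x : H →L[ℂ] H} :
    x ∈ interVonNeumann s ↔ ∀ M ∈ s, x ∈ M := by
  change x ∈ sInf (VonNeumannAlgebra.toStarSubalgebra '' s) ↔ _
  rw [StarSubalgebra.mem_sInf, Set.forall_mem_image]
  rfl

/-- The von Neumann algebra of the operators commuting with the self-adjoint operator `P`. -/
noncomputable def commutantOf (P : H →L[ℂ] H) : VonNeumannAlgebra H where
  toStarSubalgebra := StarSubalgebra.centralizer ℂ {P}
  centralizer_centralizer' := Set.centralizer_centralizer_centralizer _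

theorem mem_commutantOf {P : H →L[ℂ] H} (hP : IsSelfAdjoint P) {x : H →L[ℂ] H} :
    x ∈ commutantOf P ↔ Commute P x := by
  change x ∈ StarSubalgebra.centralizer ℂ {P} ↔ _
  simp [StarSubalgebra.mem_centralizer_iff, hP.star_eq, commute_iff_eq]

end VonNeumann

/-! ### Symbols, affiliation and factoriality. -/

/-- The symbol denoting the adjoint operator. -/
noncomputable def FieldSymbol.adjoint {A : Type*} : FieldSymbol A → FieldSymbol A
  | .phase a => .phaseAdjoint a
  | .phaseAdjoint a => .phase a
  | .boundedAbs a f => .boundedAbs a f.conj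

namespace AlgState

variable {A : Type*} [Ring A] [Algebra ℂ A] [StarRing A] [StarModule ℂ A]

theorem adjoint_symbolOp (ω : AlgState A) (i : FieldSymbol A) :
    (ω.symbolOp i).adjoint = ω.symbolOp i.adjoint := by
  cases i with
  | phase a => rfl
  | phaseAdjoint a => exact ContinuousLinearMap.adjoint_adjoint _
  | boundedAbs a f => exact adjoint_boundedFunction _ _

/-- An operator leaving, along with its adjoint, the graphs of all fields invariant commutes with
the operators denoted by symbols. -/
theorem symbolOp_commute (ω : AlgState A) {B : ω.GNS →L[ℂ] ω.GNS}
    (h1 : ∀ a x y, (x, y) ∈ (ω.fieldOperator a).graph → (B x, B y) ∈ (ω.fieldOperator a).graph)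
    (h2 : ∀ a x y, (x, y) ∈ (ω.fieldOperator a).graph →
      (B.adjoint x, B.adjoint y) ∈ (ω.fieldOperator a).graph) (i : FieldSymbol A) :
    Commute (ω.symbolOp i) B := by
  have key := fun a => (ω.isPolarDecomposition a).commute_of_graph_invariant
    (ω.isClosed_fieldOperator a) (h1 a) (h2 a)
  cases i with
  | phase a => exact (key a).2
  | phaseAdjoint a =>
    have h3 := ((ω.isPolarDecomposition a).commute_of_graph_invariant
      (ω.isClosed_fieldOperator a) (B := B.adjoint) (h2 a)
      (by simpa only [ContinuousLinearMap.adjoint_adjoint] using h1 a)).2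
    exact commute_star_comm.2 h3
  | boundedAbs a f =>
    exact boundedFunction_commute _ f (key a).1
      (.of_nonneg (resolventSq_nonneg (ω.isPolarDecomposition a).selfAdjoint.isClosed))

/-- An operator commuting with the operators denoted by symbols leaves the graphs of all fields
invariant. -/
theorem fieldOperator_graph_invariant (ω : AlgState A) {B : ω.GNS →L[ℂ] ω.GNS}
    (h : ∀ i, Commute (ω.symbolOp i) B) (a : A) (x y : ω.GNS)
    (hxy : (x, y) ∈ (ω.fieldOperator a).graph) : (B x, B y) ∈ (ω.fieldOperator a).graph := by
  have hp := ω.isPolarDecomposition a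
  have h1 := h (.boundedAbs a .linDiv)
  have h2 := h (.boundedAbs a .sqDivCube)
  change Commute (boundedFunction (ω.absValue a) _) B at h1 h2
  rw [boundedFunction_linDiv hp.selfAdjoint hp.nonneg] at h1
  rw [boundedFunction_sqDivCube hp.selfAdjoint hp.nonneg] at h2
  exact hp.graph_invariant (ω.isClosed_fieldOperator a) (ω.dense_domain_fieldOperator a)
    (h (.phase a)) h1 h2 hxy

/-- For a factorial state, a closed subspace invariant under the operators denoted by symbols and
under the operators commuting with these is trivial. -/
theorem IsFactorial.eq_bot_or_eq_top {ω : AlgState A} (hω : ω.IsFactorial)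
    (R : Submodule ℂ ω.GNS) [R.HasOrthogonalProjection]
    (h1 : ∀ i, ∀ x ∈ R, ω.symbolOp i x ∈ R)
    (h2 : ∀ B : ω.GNS →L[ℂ] ω.GNS, (∀ i, Commute (ω.symbolOp i) B) → ∀ x ∈ R, B x ∈ R) :
    R = ⊥ ∨ R = ⊤ := by
  have hPi := Intertwines.starProjection ω.adjoint_symbolOp R h1
  have hPsa : IsSelfAdjoint R.starProjection := by
    rw [ContinuousLinearMap.isSelfAdjoint_iff_isSymmetric]
    exact R.starProjection_isSymmetric
  -- If every field is affiliated to `M`, the elements of `M'` preserve all graphs, hence commute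
  -- with the symbols and preserve `R`. So the projection lies in `M'' = M`.
  have hP1 : R.starProjection ∈ ω.vonNeumannAlgebra := by
    refine mem_interVonNeumann.2 fun M hM => ?_
    rw [← M.commutant_commutant, VonNeumannAlgebra.mem_commutant_iff]
    intro B hB
    have hB' : B.adjoint ∈ M.commutant := star_mem hB
    have hg1 := fun a => hM a B hB
    have hg2 := fun a => hM a _ hB'
    have hc1 := ω.symbolOp_commute hg1 hg2
    have hc2 := ω.symbolOp_commute hg2
      (by simpa only [ContinuousLinearMap.adjoint_adjoint] using hg1)
    ext x
    exact (R.starProjection_comm B (h2 B hc1) (h2 _ hc2) x).symm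
  have hP2 : R.starProjection ∈ ω.vonNeumannAlgebra.commutant := by
    rw [VonNeumannAlgebra.mem_commutant_iff]
    intro g hg
    -- The symbols lie in the commutant of the projection `P`, so every field is affiliated to
    -- `{P}'`; minimality gives `A_ω ⊆ {P}'`.
    have hM : commutantOf R.starProjection ∈
        {M | ∀ a, IsAffiliatedTo (ω.fieldOperator a) M} := fun a B hB => by
      refine ω.fieldOperator_graph_invariant (fun i => ?_) a
      refine VonNeumannAlgebra.mem_commutant_iff.1 hB _ ((mem_commutantOf hPsa).2 ?_)
      ext x
      exact hPi i x
    exact ((mem_commutantOf hPsa).1 (mem_interVonNeumann.1 hg _ hM)).eq.symm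
  obtain ⟨c, hc⟩ := hω _ hP1 hP2
  by_cases hc0 : c = 0
  · left
    rw [Submodule.eq_bot_iff]
    intro x hx
    rw [← Submodule.starProjection_eq_self_iff.2 hx, hc, hc0, zero_smul]
    rfl
  · right
    rw [Submodule.eq_top_iff']
    intro x
    have h3 := R.starProjection_apply_mem (c⁻¹ • x)
    rw [hc] at h3
    change c • (c⁻¹ • x) ∈ R at h3
    rwa [smul_inv_smul₀ hc0] at h3

/-- If `ω₁` is factorial, and some intertwiner from the GNS space of `ω₁` to the one of `ω₂` is
nonzero, then the intertwiners separate points. -/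
theorem IsFactorial.separating {ω₁ ω₂ : AlgState A} (hω : ω₁.IsFactorial)
    (h : ∃ X : ω₁.GNS →L[ℂ] ω₂.GNS, Intertwines ω₁.symbolOp ω₂.symbolOp X ∧ X ≠ 0)
    (v : ω₁.GNS) (hv : v ≠ 0) :
    ∃ X : ω₁.GNS →L[ℂ] ω₂.GNS, Intertwines ω₁.symbolOp ω₂.symbolOp X ∧ X v ≠ 0 := by
  -- The common kernel is preserved by the symbols through intertwining, and by their commutant
  -- because `X ∘ B` is again an intertwiner.
  let R : Submodule ℂ ω₁.GNS :=
    ⨅ X : {X : ω₁.GNS →L[ℂ] ω₂.GNS // Intertwines ω₁.symbolOp ω₂.symbolOp X},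
      LinearMap.ker X.1.toLinearMap
  have hR : ∀ x, x ∈ R ↔ ∀ X : ω₁.GNS →L[ℂ] ω₂.GNS,
      Intertwines ω₁.symbolOp ω₂.symbolOp X → X x = 0 := fun x => by simp [R]
  have hRcl : IsClosed (R : Set ω₁.GNS) := by
    simp only [R, Submodule.coe_iInf]
    exact isClosed_iInter fun X => X.1.isClosed_ker
  have : CompleteSpace R := hRcl.completeSpace_coe
  have h1 : ∀ i, ∀ x ∈ R, ω₁.symbolOp i x ∈ R := fun i x hx => by
    rw [hR] at hx ⊢
    intro X hX
    rw [hX, hx X hX, map_zero]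
  have h2 : ∀ B : ω₁.GNS →L[ℂ] ω₁.GNS, (∀ i, Commute (ω₁.symbolOp i) B) → ∀ x ∈ R, B x ∈ R := by
    intro B hB x hx
    rw [hR] at hx ⊢
    intro X hX
    exact hx (X ∘L B) (hX.comp fun i y => (DFunLike.congr_fun (hB i).eq y).symm)
  rcases hω.eq_bot_or_eq_top R h1 h2 with h0 | h0
  · by_contra! hne
    have : v ∈ R := (hR v).2 hne
    rw [h0] at this
    exact hv this
  · obtain ⟨X, hX, hX0⟩ := h
    refine absurd ?_ hX0
    ext x
    have : x ∈ R := h0 ▸ Submodule.mem_top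
    exact (hR x).1 this X hX

end AlgState

/-! ### Assembly of the density matrix. -/

theorem mainTheorem10 {A : Type*} [Ring A] [Algebra ℂ A] [StarRing A] [StarModule ℂ A]
    (ω₁ ω₂ : AlgState A) (hfactor : ω₁.IsFactorial) (h : ω₂.ExcitableFrom ω₁) :
    ω₁.ExcitableFrom ω₂ := by
  obtain ⟨ρ, hρ, hw⟩ := h
  obtain ⟨s, ζ, hζ, htr⟩ := hρ.exists_vectors
  obtain ⟨k, hk⟩ : ∃ k, ζ k ≠ 0 := by
    by_contra! h0
    simp only [h0, norm_zero, ne_eq, OfNat.ofNat_ne_zero, not_false_eq_true, zero_pow] at hζ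
    exact one_ne_zero (hζ.unique hasSum_zero)
  obtain ⟨X, hX, hXk⟩ := exists_intertwiner ω₂.adjoint_symbolOp ω₁.adjoint_symbolOp
    (fun w => htr _ _ (hw w)) k
  have hsep := hfactor.separating (ω₂ := ω₂) ⟨X.adjoint,
    hX.adjoint ω₂.adjoint_symbolOp ω₁.adjoint_symbolOp, fun h0 => hk <| by
      rw [← hXk, ← ContinuousLinearMap.adjoint_adjoint X, h0]
      simp⟩
  obtain ⟨S, ξ, hξ⟩ := exists_vectors_of_separating ω₁.adjoint_symbolOp ω₂.adjoint_symbolOp hsep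
    (ω₁.vec 1)
  -- The empty word gives the normalisation, hence both square-summability of the `ξ V` and trace
  -- one.
  have h1 : HasSum (fun V => ⟪ξ V, ξ V⟫_ℂ) 1 := by
    have h2 := hξ []
    have h3 : ⟪ω₁.vec 1, ω₁.vec 1⟫_ℂ = 1 := by
      rw [AlgState.inner_vec, star_one, one_mul, ω₁.map_one]
    rw [← h3]
    exact h2
  have hsum : Summable fun V => ‖ξ V‖ ^ 2 := by
    have h2 := (Complex.hasSum_re h1).summable
    refine h2.congr fun V => ?_
    exact inner_self_eq_norm_sq (𝕜 := ℂ) (ξ V)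
  obtain ⟨τ, hτ, hτξ⟩ := exists_isPositive_hasSum hsum
  exact ⟨τ, ⟨hτ, hasTrace_comp_of_hasSum hsum hτξ (ContinuousLinearMap.id ℂ _) h1⟩,
    fun w => hasTrace_comp_of_hasSum hsum hτξ _ (hξ w)⟩
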